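/- Let $M$ be a non-empty oriented smooth $5$-manifold. Equip $T\oplus T^*$ with the inner product $(X+\xi,X+\xi)=i_X\xi$, let it act on forms by $(X+\xi)\cdot\varphi=i_X\varphi+\xi\wedge\varphi$, and let $$[X+\xi,Y+\eta]=[X,Y]+\mathcal L_X\eta-\mathcal L_Y\xi-\tfrac12 d(i_X\eta-i_Y\xi)$$ be the Courant bracket. Let $\langle\varphi,\psi\rangle=[\varphi\wedge\sigma(\psi)]_5\in\Lambda^5T^*$ be the Mukai pairing, where $\sigma=(-1)^m$ in degrees $2m$ and $2m+1$. For an even form $\varphi$ define $Q(\varphi)\in(T\oplus T^*)\otimes\Lambda^5T^*$ by $(Q(\varphi),v)=\langle v\cdot\varphi,\varphi\rangle$ for all $v\in T\oplus T^*$. For a pair $\rho=(\rho_1,\rho_2)$ of even forms put $f(\rho)=(Q(\rho_1),Q(\rho_2))\in(\Lambda^5T^*)^2$, and let $\phi(\rho)=|f(\rho)|^{1/2}$, a $5$-form that is positive for the orientation where $f(\rho)\neq 0$. Let $\rho=(\rho_1,\rho_2)$ be a smooth section of $\Lambda^{ev}T^*\otimes\mathbf R^2$ which at each point lies in an open orbit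 of $Spin(5,5)\times GL(2,\mathbf R)$, and let $\hat\rho=(\hat\rho_1,\hat\rho_2)$ be the pair of odd forms that represents the derivative of $\phi$ at $\rho$, that is, $D\phi(\dot\rho)=\langle\hat\rho_1,\dot\rho_1\rangle+\langle\hat\rho_2,\dot\rho_2\rangle$ for all $\dot\rho$. Suppose that $d\rho=0=d\hat\rho$, the equations for a critical point of the volume functional $\int_M\phi(\rho)$ in a cohomology class. Then there are smooth global sections $v_1,h,v_2$ of $T\oplus T^*$ such that $$Q(\rho_1+z\rho_2)=\phi(\rho)\otimes(v_1+2zh+z^2v_2)\qquad\text{for all } z\in\mathbf R.$$ They are linearly independent at each point, so that they span a three-dimensional real vector space $V$ of global sections. Any two sections $u,w\in V$ Courant-commute, $[u,w]=0$, and their inner product $(u,w)$ is a locally constant function on $M$; it is constant if $M$ is connected. -/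

import Mathlib

open Set Filter Topology Manifold
open scoped ContDiff

noncomputable section

namespace GenGeom

/-! ### Linear algebra on the tangent space of a 5-manifold

For a manifold modelled on `𝓡 5`, every `TangentSpace (𝓡 5) x` is by definition `E5`.
Forms and sections on `M` are therefore written as functions on `M`; their behaviour in
charts always goes through the derivatives of the charts. -/

/-- The model space `ℝ⁵`. -/
abbrev E5 : Type := EuclideanSpace ℝ (Fin 5)

/-- The fibre of `T ⊕ T*`: pairs `(X, ξ)`, standing for `X + ξ`. -/
abbrev GT : Type := E5 × (E5 →L[ℝ] ℝ)

/-- The fibre of `Λ^k T*`. -/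
abbrev KForm (k : ℕ) : Type := E5 [⋀^Fin k]→L[ℝ] ℝ

/-- The fibre of `Λ^• T*`: non-homogeneous forms (the components of degree `> 5` are `0`). -/
abbrev Forms : Type := ∀ k : ℕ, KForm k

/-- Even forms: the half-spin representation `S`. -/
def evenForms : Submodule ℝ Forms where
  carrier := {φ | ∀ k, Odd k → φ k = 0}
  add_mem' := fun ha hb k hk => by simp [ha k hk, hb k hk]
  zero_mem' := fun _ _ => rfl
  smul_mem' := fun c _ ha k hk => by simp [ha k hk]

/-- Odd forms: the opposite half-spin representation `S*`. -/
def oddForms : Submodule ℝ Forms where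
  carrier := {φ | ∀ k, Even k → φ k = 0}
  add_mem' := fun ha hb k hk => by simp [ha k hk, hb k hk]
  zero_mem' := fun _ _ => rfl
  smul_mem' := fun c _ ha k hk => by simp [ha k hk]

/-- The inner product on `T ⊕ T*`, with `(X + ξ, X + ξ) = i_X ξ`. -/
def pairing : GT →ₗ[ℝ] GT →ₗ[ℝ] ℝ :=
  LinearMap.mk₂ ℝ (fun u w => (u.2 w.1 + w.2 u.1) / 2)
    (fun _ _ _ => by simp; ring) (fun _ _ _ => by simp; ring)
    (fun _ _ _ => by simp; ring) (fun _ _ _ => by simp; ring)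

/-- The associated quadratic form, of signature `(5, 5)`. -/
def quad : QuadraticForm ℝ GT := LinearMap.BilinMap.toQuadraticMap pairing

/-- `i_X φ`. -/
def interior (X : E5) (φ : Forms) : Forms := fun k => (φ (k + 1)).curryLeft X

/-- `ξ ∧ α` for a covector `ξ` and a `k`-form `α`:
`(ξ ∧ α)(v₀, …, v_k) = ∑ᵢ (-1)^i ξ(vᵢ) α(v₀, …, v̂ᵢ, …, v_k)`. -/
def covWedge {k : ℕ} (ξ : E5 →L[ℝ] ℝ) (α : KForm k) : KForm (k + 1) :=
  ContinuousAlternatingMap.alternatizeUncurryFin (ξ.smulRight α)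

/-- `ξ ∧ φ` for a non-homogeneous form `φ`. -/
def exterior (ξ : E5 →L[ℝ] ℝ) (φ : Forms) : Forms
  | 0 => 0
  | k + 1 => covWedge ξ (φ k)

theorem covWedge_apply {k : ℕ} (ξ : E5 →L[ℝ] ℝ) (α : KForm k) (v : Fin (k + 1) → E5) :
    covWedge ξ α v = ∑ i : Fin (k + 1), (-1 : ℝ) ^ (i : ℕ) * (ξ (v i) * α (i.removeNth v)) := by
  simp [covWedge, ContinuousAlternatingMap.alternatizeUncurryFin_apply, zsmul_eq_mul]

/-- The Clifford action `(X + ξ) · φ = i_X φ + ξ ∧ φ`. -/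
def cliff : GT →ₗ[ℝ] Forms →ₗ[ℝ] Forms :=
  LinearMap.mk₂ ℝ (fun u φ => interior u.1 φ + exterior u.2 φ)
    (fun u w φ => by
      funext k; cases k <;> ext v <;>
        simp [interior, exterior, covWedge_apply, add_mul, mul_add, Finset.sum_add_distrib]; all_goals abel)
    (fun c u φ => by
      funext k; cases k <;> ext v <;>
        simp [interior, exterior, covWedge_apply, Finset.mul_sum, mul_left_comm, mul_assoc])
    (fun u φ ψ => by
      funext k; cases k <;> ext v <;>
        simp [interior, exterior, covWedge_apply, mul_add, Finset.sum_add_distrib]; all_goals abel)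
    (fun c u φ => by
      funext k; cases k <;> ext v <;>
        simp [interior, exterior, covWedge_apply, Finset.mul_sum, mul_left_comm])

theorem covWedge_covWedge {k : ℕ} (ξ : E5 →L[ℝ] ℝ) (α : KForm k) :
    covWedge ξ (covWedge ξ α) = 0 := by
  have h : ξ.smulRight (covWedge ξ α) =
      ContinuousAlternatingMap.alternatizeUncurryFinCLM ℝ E5 ℝ ∘L
        ξ.smulRight (ξ.smulRight α) := by
    ext1 X
    simp [covWedge, ← ContinuousAlternatingMap.alternatizeUncurryFinCLM_apply]
  rw [covWedge, h]
  refine ContinuousAlternatingMap.alternatizeUncurryFin_alternatizeUncurryFinCLM_comp_of_symmetric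
    fun X Y => ?_
  simp [smul_smul, mul_comm]

theorem curryLeft_covWedge_zero (X : E5) (ξ : E5 →L[ℝ] ℝ) (α : KForm 0) :
    (covWedge ξ α).curryLeft X = ξ X • α := by
  ext v
  have : v = (0 : Fin 1).removeNth (Matrix.vecCons X v) := Subsingleton.elim _ _
  simp [covWedge_apply, ← this]

theorem curryLeft_covWedge {k : ℕ} (X : E5) (ξ : E5 →L[ℝ] ℝ) (α : KForm (k + 1)) :
    (covWedge ξ α).curryLeft X = ξ X • α - covWedge ξ (α.curryLeft X) := by
  ext v
  have h0 : (0 : Fin (k + 2)).removeNth (Matrix.vecCons X v) = v := by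
    ext1 j; simp [Fin.removeNth]
  have h1 : ∀ i : Fin (k + 1), i.succ.removeNth (Matrix.vecCons X v) =
      Matrix.vecCons X (i.removeNth v) := by
    intro i
    ext1 j
    refine Fin.cases ?_ (fun j => ?_) j <;> simp [Fin.removeNth]
  rw [ContinuousAlternatingMap.curryLeft_apply_apply, covWedge_apply, Fin.sum_univ_succ]
  simp only [h0, h1, sub_eq_add_neg]
  simp [pow_succ, covWedge_apply]

theorem covWedge_add {k : ℕ} (ξ : E5 →L[ℝ] ℝ) (α β : KForm k) :
    covWedge ξ (α + β) = covWedge ξ α + covWedge ξ β := by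
  ext v
  simp [covWedge_apply, mul_add, Finset.sum_add_distrib]

theorem cliff_apply_zero (u : GT) (φ : Forms) : cliff u φ 0 = (φ 1).curryLeft u.1 := by
  simp [cliff, interior, exterior]

theorem cliff_apply_succ (u : GT) (φ : Forms) (k : ℕ) :
    cliff u φ (k + 1) = (φ (k + 2)).curryLeft u.1 + covWedge u.2 (φ k) := by
  simp [cliff, interior, exterior]

/-- The Clifford identity `(X + ξ)² = (X + ξ, X + ξ)`. -/
theorem cliff_cliff (u : GT) (φ : Forms) : cliff u (cliff u φ) = quad u • φ := by
  have hq : quad u = u.2 u.1 := by simp [quad, pairing]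
  rw [hq]
  funext k
  rw [Pi.smul_apply]
  match k with
  | 0 =>
    rw [cliff_apply_zero, cliff_apply_succ, ContinuousAlternatingMap.curryLeft_add,
      _root_.add_apply, ContinuousAlternatingMap.curryLeft_same,
      curryLeft_covWedge_zero, zero_add]
  | 1 =>
    rw [cliff_apply_succ, cliff_apply_zero, cliff_apply_succ,
      ContinuousAlternatingMap.curryLeft_add, _root_.add_apply,
      ContinuousAlternatingMap.curryLeft_same, curryLeft_covWedge]
    abel
  | k + 2 =>
    rw [cliff_apply_succ, cliff_apply_succ, cliff_apply_succ,
      ContinuousAlternatingMap.curryLeft_add, _root_.add_apply,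
      ContinuousAlternatingMap.curryLeft_same, curryLeft_covWedge, covWedge_add,
      covWedge_covWedge]
    abel

/-! ### The spin group and its open orbits -/

/-- The representation of the Clifford algebra of `T ⊕ T*` on forms. -/
def cliffordRep : CliffordAlgebra quad →ₐ[ℝ] Module.End ℝ Forms :=
  CliffordAlgebra.lift quad ⟨cliff, fun u => by
    ext1 φ
    simpa [Algebra.algebraMap_eq_smul_one] using cliff_cliff u φ⟩

/-- The orbit of `r ∈ S ⊗ ℝ²` under `Spin(5,5) × GL(2, ℝ)`. -/
def orbit (r : Fin 2 → Forms) : Set (Fin 2 → evenForms) :=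
  {s | ∃ g ∈ spinGroup quad, ∃ A : GL (Fin 2) ℝ,
    ∀ i, (s i : Forms) = ∑ j, (A : Matrix (Fin 2) (Fin 2) ℝ) i j • cliffordRep g (r j)}

/-- `r` is a pair of even forms that lies in an open orbit of `Spin(5,5) × GL(2, ℝ)`. -/
def IsStable (r : Fin 2 → Forms) : Prop :=
  (∀ i, r i ∈ evenForms) ∧ IsOpen (orbit r)

/-! ### The Mukai pairing, the quartic and the volume form -/

/-- The wedge product of two forms, with the standard normalisation (a sum over shuffles). -/
def wedge {k l : ℕ} (α : KForm k) (β : KForm l) : E5 [⋀^Fin (k + l)]→ₗ[ℝ] ℝ :=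
  ((LinearMap.mul' ℝ ℝ).compAlternatingMap
    (α.toAlternatingMap.domCoprod β.toAlternatingMap)).domDomCongr finSumFinEquiv

/-- The Mukai pairing `⟨φ, ψ⟩ = [φ ∧ σ(ψ)]₅`, with `σ = (-1)^m` in degrees `2m` and `2m + 1`. -/
def mukai (φ ψ : Forms) : E5 [⋀^Fin 5]→ₗ[ℝ] ℝ :=
  (wedge (φ 0) (ψ 5) : E5 [⋀^Fin (0 + 5)]→ₗ[ℝ] ℝ)
    + (wedge (φ 1) (ψ 4) : E5 [⋀^Fin (1 + 4)]→ₗ[ℝ] ℝ)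
    - (wedge (φ 2) (ψ 3) : E5 [⋀^Fin (2 + 3)]→ₗ[ℝ] ℝ)
    - (wedge (φ 3) (ψ 2) : E5 [⋀^Fin (3 + 2)]→ₗ[ℝ] ℝ)
    + (wedge (φ 4) (ψ 1) : E5 [⋀^Fin (4 + 1)]→ₗ[ℝ] ℝ)
    + (wedge (φ 5) (ψ 0) : E5 [⋀^Fin (5 + 0)]→ₗ[ℝ] ℝ)

/-- The standard basis of `ℝ⁵`. -/
def stdVec (i : Fin 5) : E5 := EuclideanSpace.single i 1

/-- The dual basis. -/
def stdCovec (i : Fin 5) : E5 →L[ℝ] ℝ := EuclideanSpace.proj i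

/-- The number `c` with `μ = c • ν`, for top forms `μ` and `ν ≠ 0`. -/
def ratio (μ : E5 [⋀^Fin 5]→ₗ[ℝ] ℝ) (ν : KForm 5) : ℝ := μ stdVec / ν stdVec

/-- `P(φ, ψ) ∈ (T ⊕ T*) ⊗ Λ⁵T*`, which is defined by `(P(φ, ψ), v) = ⟨v · φ, ψ⟩` for all `v`.
We write `P(φ, ψ) = ν ⊗ spinorVec ν φ ψ` for a non-zero top form `ν`. -/
def spinorVec (ν : KForm 5) (φ ψ : Forms) : GT :=
  (∑ i, (2 * ratio (mukai (cliff (0, stdCovec i) φ) ψ) ν) • stdVec i,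
   ∑ i, (2 * ratio (mukai (cliff (stdVec i, 0) φ) ψ) ν) • stdCovec i)

/-- `Q(φ) = P(φ, φ)`, relative to the top form `ν`: `Q(φ) = ν ⊗ spinorSq ν φ`. -/
def spinorSq (ν : KForm 5) (φ : Forms) : GT := spinorVec ν φ φ

/-- The quartic `f(r) = (Q(r₁), Q(r₂)) ∈ (Λ⁵T*)²`, relative to `ν`: `f(r) = quartic ν r • ν²`. -/
def quartic (ν : KForm 5) (r : Fin 2 → Forms) : ℝ :=
  pairing (spinorSq ν (r 0)) (spinorSq ν (r 1))

/-- The invariant volume form `ϕ(r) = |f(r)|^{1/2}`, positive for the orientation given by `ν`.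
It depends on `ν` through this orientation only. -/
def volForm (ν : KForm 5) (r : Fin 2 → Forms) : KForm 5 := √|quartic ν r| • ν

/-- `s = (s₁, s₂)` represents the derivative of the volume form `ϕ` at `r`: the `sᵢ` are odd, and
`Dϕ(t) = ⟨s₁, t₁⟩ + ⟨s₂, t₂⟩` for all pairs `t` of even forms (both sides divided by `ν`). -/
def RepresentsVolDeriv (ν : KForm 5) (r s : Fin 2 → Forms) : Prop :=
  (∀ i, s i ∈ oddForms) ∧ ∀ t : Fin 2 → Forms, (∀ i, t i ∈ evenForms) →
    HasDerivAt (fun ε : ℝ => √|quartic ν (r + ε • t)|) (∑ i, ratio (mukai (s i) (t i)) ν) 0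

/-- `ρ̂`: the pair of odd forms that represents the derivative of the volume form at `r`. -/
def hat (ν : KForm 5) (r : Fin 2 → Forms) : Fin 2 → Forms :=
  Classical.epsilon (RepresentsVolDeriv ν r)

/-! ### Calculus on a 5-manifold -/

variable {M : Type*} [TopologicalSpace M] [ChartedSpace E5 M]

/-- The expression of a `k`-form in the preferred chart at `x₀`. -/
def inChart {k : ℕ} (x₀ : M) (α : M → KForm k) : E5 → KForm k := fun y =>
  (α ((extChartAt (𝓡 5) x₀).symm y)).compContinuousLinearMap
    (mfderiv 𝓘(ℝ, E5) (𝓡 5) (extChartAt (𝓡 5) x₀).symm y : E5 →L[ℝ] E5)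

/-- Smoothness of a `k`-form. -/
def SmoothForm {k : ℕ} (α : M → KForm k) : Prop :=
  ∀ x₀ : M, ContDiffOn ℝ ∞ (inChart x₀ α) (extChartAt (𝓡 5) x₀).target

/-- The exterior derivative of a `k`-form: at `x₀`, the exterior derivative of its expression in
the chart at `x₀`, pulled back by this chart. -/
def extD {k : ℕ} (α : M → KForm k) (x₀ : M) : KForm (k + 1) :=
  (extDeriv (inChart x₀ α) (extChartAt (𝓡 5) x₀ x₀)).compContinuousLinearMap
    (mfderiv (𝓡 5) 𝓘(ℝ, E5) (extChartAt (𝓡 5) x₀) x₀ : E5 →L[ℝ] E5)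

/-- The exterior derivative of a non-homogeneous form. -/
def extDForms (α : M → Forms) (x : M) : Forms
  | 0 => 0
  | k + 1 => extD (fun y => α y k) x

/-- A function as a `0`-form. -/
def zeroForm (f : M → ℝ) : M → KForm 0 := fun x => .constOfIsEmpty ℝ E5 (Fin 0) (f x)

/-- A covector field as a `1`-form. -/
def oneForm (ξ : M → (E5 →L[ℝ] ℝ)) : M → KForm 1 := fun x =>
  ContinuousAlternatingMap.ofSubsingleton ℝ E5 ℝ (0 : Fin 1) (ξ x)

/-- The differential `df` as a covector field. -/
def diff (f : M → ℝ) : M → (E5 →L[ℝ] ℝ) := fun x =>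
  (ContinuousAlternatingMap.ofSubsingleton ℝ E5 ℝ (0 : Fin 1)).symm (extD (zeroForm f) x)

/-- The Lie derivative of a covector field: `L_X ξ = i_X dξ + d(i_X ξ)`. -/
def lieD (X : M → E5) (ξ : M → (E5 →L[ℝ] ℝ)) : M → (E5 →L[ℝ] ℝ) := fun x =>
  (ContinuousAlternatingMap.ofSubsingleton ℝ E5 ℝ (0 : Fin 1)).symm
    ((extD (oneForm ξ) x).curryLeft (X x)) + diff (fun y => ξ y (X y)) x

/-- The Courant bracket
`[X + ξ, Y + η] = [X, Y] + L_X η - L_Y ξ - ½ d(i_X η - i_Y ξ)`. -/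
def courant (u w : M → GT) : M → GT := fun x =>
  (VectorField.mlieBracket (𝓡 5) (fun y => (u y).1) (fun y => (w y).1) x,
   lieD (fun y => (u y).1) (fun y => (w y).2) x - lieD (fun y => (w y).1) (fun y => (u y).2) x
    - (1 / 2 : ℝ) • diff (fun y => (w y).2 (u y).1 - (u y).2 (w y).1) x)

/-- Smoothness of a section of `T ⊕ T*`. -/
def SmoothSection [IsManifold (𝓡 5) ∞ M] (u : M → GT) : Prop :=
  ContMDiff (𝓡 5) (𝓡 5).tangent ∞ (fun x => (⟨x, (u x).1⟩ : TangentBundle (𝓡 5) M)) ∧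
    SmoothForm (oneForm fun x => (u x).2)

end GenGeom

end

open GenGeom

/-!
Everything rests on the Fierz identity `Q(φ) · φ = 0` for even forms (`cliff_spinorSq_self`),
which is checked in coordinates. Polarised, it says that the coefficients `v₁, h, v₂` of `Q(ρ₁ + z
ρ₂) / ϕ(ρ)` have the Gram matrix with `(v₁, v₂) = ±1`, `(h, h) = ∓1/2` and zeros elsewhere, hence
are linearly independent (`linearIndependent_distinguished`), and that for every constant
combination `u` of them the forms `u · ρ₁` and `u · ρ₂` are constant combinations of `Q(ρ₂) · ρ₁`
and `Q(ρ₁) · ρ₂`, divided by `ϕ(ρ)` (`cliff_distinguished`). By an explicit differentiation these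
two are the components of `ρ̂`, up to a sign (`hat_eq_volDeriv`). This needs that the quartic does
not vanish on an open orbit: it is invariant up to a factor, so otherwise it would vanish on an
open set, hence identically (`IsStable.quartic_ne_zero`).

So `dρ = 0 = dρ̂` gives `dρᵢ = 0` and `d(u · ρᵢ) = 0`: the Lie derivative of `ρᵢ` along `u`, which
is `d(u · ρᵢ) + u · dρᵢ`, vanishes (`dirD_eq_neg_spinAction`). It acts on forms and on `T ⊕ T*`
compatibly with the Clifford action, and preserves the Mukai pairing up to a divergence. Therefore
the Dorfman bracket `u ∘ w` is `-l w` for each `w` among `v₁, h, v₂`, with one common function `l`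
(`fderiv_spinorVec_add_vecAction`); since `(v₁, v₂)² = 1` is constant, `l = 0`, and all Dorfman
brackets vanish (`dorfman_distinguished`). As `u ∘ w + w ∘ u = d(u, w)`, up to the normalisation
of the inner product, `(u, w)` is locally constant, and the Courant bracket, which is the skew
part of the Dorfman bracket, vanishes as well.

The computation takes place in `ℝ⁵`. All constructions are natural under linear isomorphisms,
which allows it to be carried out at the centre of each preferred chart of the manifold, where the
derivative of the chart is the identity (`IsCriticalPair.dorfman`).
-/

noncomputable section

namespace GenGeom

/-! ### Coordinates of forms on the standard basis -/

/-- The coordinate `α(e_{v 0}, …, e_{v (k-1)})` of a `k`-form. -/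
def coord {k : ℕ} (α : KForm k) (v : Fin k → Fin 5) : ℝ := α fun i => stdVec (v i)

/-- The standard basis of `ℝ⁵`, as a `Module.Basis`. -/
def stdBasis : Module.Basis (Fin 5) ℝ E5 := (EuclideanSpace.basisFun (Fin 5) ℝ).toBasis

theorem stdBasis_apply (i : Fin 5) : stdBasis i = stdVec i := by
  simp [stdBasis, stdVec]

theorem stdCovec_stdVec (i j : Fin 5) : stdCovec i (stdVec j) = if i = j then 1 else 0 := by
  simp [stdCovec, stdVec]

theorem sum_smul_stdVec (X : E5) : ∑ i, X i • stdVec i = X := by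
  simpa [stdVec, stdBasis] using stdBasis.sum_repr X

theorem sum_smul_stdCovec (ξ : E5 →L[ℝ] ℝ) : ∑ i, ξ (stdVec i) • stdCovec i = ξ := by
  ext X
  conv_rhs => rw [← sum_smul_stdVec X]
  simp [stdCovec, mul_comm]

theorem coord_cons {k : ℕ} (α : KForm (k + 1)) (i : Fin 5) (v : Fin k → Fin 5) :
    coord α (Matrix.vecCons i v) = coord (α.curryLeft (stdVec i)) v := by
  simp only [coord, ContinuousAlternatingMap.curryLeft_apply_apply]
  congr 1
  ext1 j
  refine Fin.cases ?_ (fun j => ?_) j <;> simp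

theorem coord_eq_zero_of_not_injective {k : ℕ} (α : KForm k) (v : Fin k → Fin 5)
    (hv : ¬ Function.Injective v) : coord α v = 0 := by
  refine α.toAlternatingMap.map_eq_zero_of_not_injective _ fun h => hv ?_
  exact fun i j hij => h (by simp [hij])

theorem coord_comp_perm {k : ℕ} (α : KForm k) (v : Fin k → Fin 5) (σ : Equiv.Perm (Fin k)) :
    coord α (v ∘ σ) = Equiv.Perm.sign σ • coord α v :=
  α.toAlternatingMap.map_perm (fun i => stdVec (v i)) σ

/-- A form is determined by its coordinates with strictly increasing indices. -/
theorem kform_ext {k : ℕ} {α β : KForm k}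
    (h : ∀ v : Fin k → Fin 5, StrictMono v → coord α v = coord β v) : α = β := by
  apply ContinuousAlternatingMap.toAlternatingMap_injective
  refine Module.Basis.ext_alternating stdBasis fun v hv => ?_
  simp only [stdBasis_apply]
  have hs : StrictMono (v ∘ Tuple.sort v) :=
    (Tuple.monotone_sort v).strictMono_of_injective (hv.comp (Tuple.sort v).injective)
  have := h _ hs
  rw [coord_comp_perm, coord_comp_perm] at this
  exact smul_left_cancel _ this

theorem kform_eq_zero_of_five_lt {k : ℕ} (hk : 5 < k) (α : KForm k) : α = 0 := by
  refine kform_ext fun v hv => absurd (Fintype.card_le_of_injective v hv.injective) ?_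
  simpa using hk

instance finiteDimensional_kform (k : ℕ) : FiniteDimensional ℝ (KForm k) := by
  let f : KForm k →ₗ[ℝ] ((Fin k → Fin 5) → ℝ) :=
    { toFun := fun α v => coord α v
      map_add' := fun _ _ => rfl
      map_smul' := fun _ _ => rfl }
  exact Module.Finite.of_injective f fun α β h => kform_ext fun v _ => congrFun h v

/-! ### Sorting the indices of a coordinate -/

theorem coord_self₀ {m : ℕ} (α : KForm (m + 2)) (i : Fin 5) (w : Fin m → Fin 5) :
    coord α (Matrix.vecCons i (Matrix.vecCons i w)) = 0 :=
  coord_eq_zero_of_not_injective _ _ fun h => absurd (@h 0 1 rfl) (by simp)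

/-- The inequality between the indices orients this identity, so that as a rewriting rule it sorts
them. -/
theorem coord_swap₀ {m : ℕ} (α : KForm (m + 2)) (i j : Fin 5) (w : Fin m → Fin 5) (_ : j < i) :
    coord α (Matrix.vecCons i (Matrix.vecCons j w)) =
      -coord α (Matrix.vecCons j (Matrix.vecCons i w)) := by
  have h : Matrix.vecCons i (Matrix.vecCons j w) =
      Matrix.vecCons j (Matrix.vecCons i w) ∘ Equiv.swap 0 1 := by
    ext1 a
    refine Fin.cases (by simp) (fun a => ?_) a
    refine Fin.cases (by simp) (fun a => ?_) a
    have h1 : Equiv.swap (0 : Fin (m + 2)) 1 a.succ.succ = a.succ.succ :=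
      Equiv.swap_apply_of_ne_of_ne (Fin.succ_ne_zero _)
        (fun h => Fin.succ_ne_zero a (Fin.succ_injective _ h))
    rw [Function.comp_apply, h1]
    simp
  rw [h, coord_comp_perm, Equiv.Perm.sign_swap (by simp)]
  simp

theorem coord_self₁ {m : ℕ} (α : KForm (m + 3)) (a i : Fin 5) (w : Fin m → Fin 5) :
    coord α (Matrix.vecCons a (Matrix.vecCons i (Matrix.vecCons i w))) = 0 := by
  rw [coord_cons, coord_self₀]

theorem coord_swap₁ {m : ℕ} (α : KForm (m + 3)) (a i j : Fin 5) (w : Fin m → Fin 5) (h : j < i) :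
    coord α (Matrix.vecCons a (Matrix.vecCons i (Matrix.vecCons j w))) =
      -coord α (Matrix.vecCons a (Matrix.vecCons j (Matrix.vecCons i w))) := by
  rw [coord_cons, coord_swap₀ _ _ _ _ h, ← coord_cons]

theorem coord_self₂ {m : ℕ} (α : KForm (m + 4)) (a b i : Fin 5) (w : Fin m → Fin 5) :
    coord α (Matrix.vecCons a (Matrix.vecCons b (Matrix.vecCons i (Matrix.vecCons i w)))) = 0 := by
  rw [coord_cons, coord_self₁]

theorem coord_swap₂ {m : ℕ} (α : KForm (m + 4)) (a b i j : Fin 5) (w : Fin m → Fin 5)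
    (h : j < i) :
    coord α (Matrix.vecCons a (Matrix.vecCons b (Matrix.vecCons i (Matrix.vecCons j w)))) =
      -coord α (Matrix.vecCons a (Matrix.vecCons b (Matrix.vecCons j (Matrix.vecCons i w)))) := by
  rw [coord_cons, coord_swap₁ _ _ _ _ _ h, ← coord_cons]

theorem coord_self₃ {m : ℕ} (α : KForm (m + 5)) (a b c i : Fin 5) (w : Fin m → Fin 5) :
    coord α (Matrix.vecCons a (Matrix.vecCons b (Matrix.vecCons c
      (Matrix.vecCons i (Matrix.vecCons i w))))) = 0 := by
  rw [coord_cons, coord_self₂]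

theorem coord_swap₃ {m : ℕ} (α : KForm (m + 5)) (a b c i j : Fin 5) (w : Fin m → Fin 5)
    (h : j < i) :
    coord α (Matrix.vecCons a (Matrix.vecCons b (Matrix.vecCons c
      (Matrix.vecCons i (Matrix.vecCons j w))))) =
      -coord α (Matrix.vecCons a (Matrix.vecCons b (Matrix.vecCons c
        (Matrix.vecCons j (Matrix.vecCons i w))))) := by
  rw [coord_cons, coord_swap₂ _ _ _ _ _ _ h, ← coord_cons]

/-! ### The Mukai pairing in coordinates -/

/-- The wedge product as a sum over any system of representatives for the shuffles. The
representatives are distinguished by the set of slots that they assign to the first factor. -/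
theorem wedge_apply {k l N : ℕ} (rep : Fin N → Equiv.Perm (Fin k ⊕ Fin l))
    (hN : N * (k.factorial * l.factorial) = (k + l).factorial)
    (hrep : ∀ p q, (∀ a, (((rep p)⁻¹ * rep q) (Sum.inl a)).isLeft) → p = q)
    (α : KForm k) (β : KForm l) (v : Fin (k + l) → E5) :
    wedge α β v = ∑ p, (Equiv.Perm.sign (rep p) : ℤ) *
      (α (fun i => v (finSumFinEquiv (rep p (Sum.inl i)))) *
        β (fun i => v (finSumFinEquiv (rep p (Sum.inr i))))) := by
  classical
  let f : Fin N → Equiv.Perm.ModSumCongr (Fin k) (Fin l) := fun p => Quotient.mk'' (rep p)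
  have hinj : Function.Injective f := by
    intro p q h
    apply hrep
    have h' : (rep p)⁻¹ * rep q ∈ (Equiv.Perm.sumCongrHom (Fin k) (Fin l)).range :=
      QuotientGroup.leftRel_apply.mp (Quotient.exact' h)
    obtain ⟨⟨s, t⟩, hst⟩ := h'
    intro a
    rw [← hst]
    simp
  have hcard : Fintype.card (Fin N) =
      Fintype.card (Equiv.Perm.ModSumCongr (Fin k) (Fin l)) := by
    have h1 := Subgroup.card_eq_card_quotient_mul_card_subgroup
      (Equiv.Perm.sumCongrHom (Fin k) (Fin l)).range
    have h2 : Nat.card (Equiv.Perm.sumCongrHom (Fin k) (Fin l)).range =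
        k.factorial * l.factorial := by
      rw [← Nat.card_congr (MonoidHom.ofInjective
        (Equiv.Perm.sumCongrHom_injective (α := Fin k) (β := Fin l))).toEquiv]
      simp [Fintype.card_perm]
    rw [h2, Nat.card_eq_fintype_card, Fintype.card_perm, Fintype.card_sum, Fintype.card_fin,
      Fintype.card_fin, ← hN] at h1
    have h3 := Nat.eq_of_mul_eq_mul_right
      (Nat.mul_pos (Nat.factorial_pos _) (Nat.factorial_pos _)) h1
    rw [Fintype.card_fin, h3]
    exact Nat.card_eq_fintype_card
  have hbij : Function.Bijective f := (Fintype.bijective_iff_injective_and_card f).2 ⟨hinj, hcard⟩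
  have h0 : wedge α β v = LinearMap.mul' ℝ ℝ
      ((α.toAlternatingMap.domCoprod β.toAlternatingMap) fun i => v (finSumFinEquiv i)) := rfl
  rw [h0, AlternatingMap.domCoprod_apply, _root_.sum_apply, ← hbij.sum_comp, map_sum]
  refine Finset.sum_congr rfl fun p _ => ?_
  rw [show f p = Quotient.mk'' (rep p) from rfl, AlternatingMap.domCoprod.summand_mk'']
  change LinearMap.mul' ℝ ℝ ((Equiv.Perm.sign (rep p) : ℤ) • (_ ⊗ₜ[ℝ] _)) = _
  rw [map_zsmul, zsmul_eq_mul, LinearMap.mul'_apply]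
  rfl

/-- The coordinate form of `wedge_apply` in top degree. -/
theorem wedge_stdVec {k l N : ℕ} (hkl : k + l = 5) (shuffle : Fin N → Equiv.Perm (Fin 5))
    (hN : N * (k.factorial * l.factorial) = (k + l).factorial)
    (S : Fin N → Fin k → Fin 5) (T : Fin N → Fin l → Fin 5) (ε : Fin N → ℤ)
    (hS : ∀ p i, shuffle p (Fin.cast hkl (Fin.castAdd l i)) = S p i)
    (hT : ∀ p i, shuffle p (Fin.cast hkl (Fin.natAdd k i)) = T p i)
    (hST : ∀ p q, (∀ i, ∃ j, S q i = S p j) → p = q)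
    (hε : ∀ p, (Equiv.Perm.sign (shuffle p) : ℤ) = ε p)
    (α : KForm k) (β : KForm l) :
    wedge α β (fun i => stdVec (Fin.cast hkl i)) =
      ∑ p, (ε p : ℝ) * (coord α (S p) * coord β (T p)) := by
  let e : Fin 5 ≃ Fin k ⊕ Fin l := (finCongr hkl.symm).trans finSumFinEquiv.symm
  have heS : ∀ p i, e.symm (e.permCongr (shuffle p) (Sum.inl i)) = S p i := fun p i => by
    simpa [e, Equiv.permCongr_apply] using hS p i
  have heT : ∀ p i, e.symm (e.permCongr (shuffle p) (Sum.inr i)) = T p i := fun p i => by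
    simpa [e, Equiv.permCongr_apply] using hT p i
  rw [wedge_apply (fun p => e.permCongr (shuffle p)) hN]
  · refine Finset.sum_congr rfl fun p _ => ?_
    rw [Equiv.Perm.sign_permCongr, hε]
    congr 2
    · exact congrArg α (funext fun i => congrArg stdVec (heS p i))
    · exact congrArg β (funext fun i => congrArg stdVec (heT p i))
  · intro p q h
    refine hST p q fun i => ?_
    obtain ⟨j, hj⟩ := Sum.isLeft_iff.1 (h i)
    refine ⟨j, ?_⟩
    rw [← heS, ← heS, ← hj]
    simp

set_option maxRecDepth 10000 in
theorem wedge_zero_five (α : KForm 0) (β : KForm 5) :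
    (wedge α β : E5 [⋀^Fin (0 + 5)]→ₗ[ℝ] ℝ) stdVec =
      coord α ![] * coord β ![0, 1, 2, 3, 4] := by
  refine (wedge_stdVec (N := 1) rfl
    ![⟨![0, 1, 2, 3, 4], ![0, 1, 2, 3, 4], by decide, by decide⟩]
    (by decide)
    ![![]]
    ![![0, 1, 2, 3, 4]]
    ![1]
    (by decide) (by decide) (by decide) (by decide) α β).trans ?_
  simp

set_option maxRecDepth 10000 in
theorem wedge_one_four (α : KForm 1) (β : KForm 4) :
    (wedge α β : E5 [⋀^Fin (1 + 4)]→ₗ[ℝ] ℝ) stdVec =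
      coord α ![0] * coord β ![1, 2, 3, 4]
      - coord α ![1] * coord β ![0, 2, 3, 4]
      + coord α ![2] * coord β ![0, 1, 3, 4]
      - coord α ![3] * coord β ![0, 1, 2, 4]
      + coord α ![4] * coord β ![0, 1, 2, 3] := by
  refine (wedge_stdVec (N := 5) rfl
    ![⟨![0, 1, 2, 3, 4], ![0, 1, 2, 3, 4], by decide, by decide⟩,
      ⟨![1, 0, 2, 3, 4], ![1, 0, 2, 3, 4], by decide, by decide⟩,
      ⟨![2, 0, 1, 3, 4], ![1, 2, 0, 3, 4], by decide, by decide⟩,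
      ⟨![3, 0, 1, 2, 4], ![1, 2, 3, 0, 4], by decide, by decide⟩,
      ⟨![4, 0, 1, 2, 3], ![1, 2, 3, 4, 0], by decide, by decide⟩]
    (by decide)
    ![![0], ![1], ![2], ![3], ![4]]
    ![![1, 2, 3, 4], ![0, 2, 3, 4], ![0, 1, 3, 4], ![0, 1, 2, 4], ![0, 1, 2, 3]]
    ![1, -1, 1, -1, 1]
    (by decide) (by decide) (by decide) (by decide) α β).trans ?_
  simp [Fin.sum_univ_succ]
  ring

set_option maxRecDepth 10000 in
theorem wedge_two_three (α : KForm 2) (β : KForm 3) :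
    (wedge α β : E5 [⋀^Fin (2 + 3)]→ₗ[ℝ] ℝ) stdVec =
      coord α ![0, 1] * coord β ![2, 3, 4]
      - coord α ![0, 2] * coord β ![1, 3, 4]
      + coord α ![0, 3] * coord β ![1, 2, 4]
      - coord α ![0, 4] * coord β ![1, 2, 3]
      + coord α ![1, 2] * coord β ![0, 3, 4]
      - coord α ![1, 3] * coord β ![0, 2, 4]
      + coord α ![1, 4] * coord β ![0, 2, 3]
      + coord α ![2, 3] * coord β ![0, 1, 4]
      - coord α ![2, 4] * coord β ![0, 1, 3]
      + coord α ![3, 4] * coord β ![0, 1, 2] := by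
  refine (wedge_stdVec (N := 10) rfl
    ![⟨![0, 1, 2, 3, 4], ![0, 1, 2, 3, 4], by decide, by decide⟩,
      ⟨![0, 2, 1, 3, 4], ![0, 2, 1, 3, 4], by decide, by decide⟩,
      ⟨![0, 3, 1, 2, 4], ![0, 2, 3, 1, 4], by decide, by decide⟩,
      ⟨![0, 4, 1, 2, 3], ![0, 2, 3, 4, 1], by decide, by decide⟩,
      ⟨![1, 2, 0, 3, 4], ![2, 0, 1, 3, 4], by decide, by decide⟩,
      ⟨![1, 3, 0, 2, 4], ![2, 0, 3, 1, 4], by decide, by decide⟩,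
      ⟨![1, 4, 0, 2, 3], ![2, 0, 3, 4, 1], by decide, by decide⟩,
      ⟨![2, 3, 0, 1, 4], ![2, 3, 0, 1, 4], by decide, by decide⟩,
      ⟨![2, 4, 0, 1, 3], ![2, 3, 0, 4, 1], by decide, by decide⟩,
      ⟨![3, 4, 0, 1, 2], ![2, 3, 4, 0, 1], by decide, by decide⟩]
    (by decide)
    ![![0, 1], ![0, 2], ![0, 3], ![0, 4], ![1, 2],
      ![1, 3], ![1, 4], ![2, 3], ![2, 4], ![3, 4]]
    ![![2, 3, 4], ![1, 3, 4], ![1, 2, 4], ![1, 2, 3], ![0, 3, 4],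
      ![0, 2, 4], ![0, 2, 3], ![0, 1, 4], ![0, 1, 3], ![0, 1, 2]]
    ![1, -1, 1, -1, 1, -1, 1, 1, -1, 1]
    (by decide) (by decide) (by decide) (by decide) α β).trans ?_
  simp [Fin.sum_univ_succ]
  ring

set_option maxRecDepth 10000 in
theorem wedge_three_two (α : KForm 3) (β : KForm 2) :
    (wedge α β : E5 [⋀^Fin (3 + 2)]→ₗ[ℝ] ℝ) stdVec =
      coord α ![0, 1, 2] * coord β ![3, 4]
      - coord α ![0, 1, 3] * coord β ![2, 4]
      + coord α ![0, 1, 4] * coord β ![2, 3]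
      + coord α ![0, 2, 3] * coord β ![1, 4]
      - coord α ![0, 2, 4] * coord β ![1, 3]
      + coord α ![0, 3, 4] * coord β ![1, 2]
      - coord α ![1, 2, 3] * coord β ![0, 4]
      + coord α ![1, 2, 4] * coord β ![0, 3]
      - coord α ![1, 3, 4] * coord β ![0, 2]
      + coord α ![2, 3, 4] * coord β ![0, 1] := by
  refine (wedge_stdVec (N := 10) rfl
    ![⟨![0, 1, 2, 3, 4], ![0, 1, 2, 3, 4], by decide, by decide⟩,
      ⟨![0, 1, 3, 2, 4], ![0, 1, 3, 2, 4], by decide, by decide⟩,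
      ⟨![0, 1, 4, 2, 3], ![0, 1, 3, 4, 2], by decide, by decide⟩,
      ⟨![0, 2, 3, 1, 4], ![0, 3, 1, 2, 4], by decide, by decide⟩,
      ⟨![0, 2, 4, 1, 3], ![0, 3, 1, 4, 2], by decide, by decide⟩,
      ⟨![0, 3, 4, 1, 2], ![0, 3, 4, 1, 2], by decide, by decide⟩,
      ⟨![1, 2, 3, 0, 4], ![3, 0, 1, 2, 4], by decide, by decide⟩,
      ⟨![1, 2, 4, 0, 3], ![3, 0, 1, 4, 2], by decide, by decide⟩,
      ⟨![1, 3, 4, 0, 2], ![3, 0, 4, 1, 2], by decide, by decide⟩,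
      ⟨![2, 3, 4, 0, 1], ![3, 4, 0, 1, 2], by decide, by decide⟩]
    (by decide)
    ![![0, 1, 2], ![0, 1, 3], ![0, 1, 4], ![0, 2, 3], ![0, 2, 4],
      ![0, 3, 4], ![1, 2, 3], ![1, 2, 4], ![1, 3, 4], ![2, 3, 4]]
    ![![3, 4], ![2, 4], ![2, 3], ![1, 4], ![1, 3],
      ![1, 2], ![0, 4], ![0, 3], ![0, 2], ![0, 1]]
    ![1, -1, 1, 1, -1, 1, -1, 1, -1, 1]
    (by decide) (by decide) (by decide) (by decide) α β).trans ?_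
  simp [Fin.sum_univ_succ]
  ring

set_option maxRecDepth 10000 in
theorem wedge_four_one (α : KForm 4) (β : KForm 1) :
    (wedge α β : E5 [⋀^Fin (4 + 1)]→ₗ[ℝ] ℝ) stdVec =
      coord α ![0, 1, 2, 3] * coord β ![4]
      - coord α ![0, 1, 2, 4] * coord β ![3]
      + coord α ![0, 1, 3, 4] * coord β ![2]
      - coord α ![0, 2, 3, 4] * coord β ![1]
      + coord α ![1, 2, 3, 4] * coord β ![0] := by
  refine (wedge_stdVec (N := 5) rfl
    ![⟨![0, 1, 2, 3, 4], ![0, 1, 2, 3, 4], by decide, by decide⟩,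
      ⟨![0, 1, 2, 4, 3], ![0, 1, 2, 4, 3], by decide, by decide⟩,
      ⟨![0, 1, 3, 4, 2], ![0, 1, 4, 2, 3], by decide, by decide⟩,
      ⟨![0, 2, 3, 4, 1], ![0, 4, 1, 2, 3], by decide, by decide⟩,
      ⟨![1, 2, 3, 4, 0], ![4, 0, 1, 2, 3], by decide, by decide⟩]
    (by decide)
    ![![0, 1, 2, 3], ![0, 1, 2, 4], ![0, 1, 3, 4], ![0, 2, 3, 4], ![1, 2, 3, 4]]
    ![![4], ![3], ![2], ![1], ![0]]
    ![1, -1, 1, -1, 1]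
    (by decide) (by decide) (by decide) (by decide) α β).trans ?_
  simp [Fin.sum_univ_succ]
  ring

set_option maxRecDepth 10000 in
theorem wedge_five_zero (α : KForm 5) (β : KForm 0) :
    (wedge α β : E5 [⋀^Fin (5 + 0)]→ₗ[ℝ] ℝ) stdVec =
      coord α ![0, 1, 2, 3, 4] * coord β ![] := by
  refine (wedge_stdVec (N := 1) rfl
    ![⟨![0, 1, 2, 3, 4], ![0, 1, 2, 3, 4], by decide, by decide⟩]
    (by decide)
    ![![0, 1, 2, 3, 4]]
    ![![]]
    ![1]
    (by decide) (by decide) (by decide) (by decide) α β).trans ?_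
  simp

theorem mukai_stdVec (φ ψ : Forms) : mukai φ ψ stdVec =
      coord (φ 0) ![] * coord (ψ 5) ![0, 1, 2, 3, 4]
      + coord (φ 1) ![0] * coord (ψ 4) ![1, 2, 3, 4]
      - coord (φ 1) ![1] * coord (ψ 4) ![0, 2, 3, 4]
      + coord (φ 1) ![2] * coord (ψ 4) ![0, 1, 3, 4]
      - coord (φ 1) ![3] * coord (ψ 4) ![0, 1, 2, 4]
      + coord (φ 1) ![4] * coord (ψ 4) ![0, 1, 2, 3]
      - coord (φ 2) ![0, 1] * coord (ψ 3) ![2, 3, 4]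
      + coord (φ 2) ![0, 2] * coord (ψ 3) ![1, 3, 4]
      - coord (φ 2) ![0, 3] * coord (ψ 3) ![1, 2, 4]
      + coord (φ 2) ![0, 4] * coord (ψ 3) ![1, 2, 3]
      - coord (φ 2) ![1, 2] * coord (ψ 3) ![0, 3, 4]
      + coord (φ 2) ![1, 3] * coord (ψ 3) ![0, 2, 4]
      - coord (φ 2) ![1, 4] * coord (ψ 3) ![0, 2, 3]
      - coord (φ 2) ![2, 3] * coord (ψ 3) ![0, 1, 4]
      + coord (φ 2) ![2, 4] * coord (ψ 3) ![0, 1, 3]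
      - coord (φ 2) ![3, 4] * coord (ψ 3) ![0, 1, 2]
      - coord (φ 3) ![0, 1, 2] * coord (ψ 2) ![3, 4]
      + coord (φ 3) ![0, 1, 3] * coord (ψ 2) ![2, 4]
      - coord (φ 3) ![0, 1, 4] * coord (ψ 2) ![2, 3]
      - coord (φ 3) ![0, 2, 3] * coord (ψ 2) ![1, 4]
      + coord (φ 3) ![0, 2, 4] * coord (ψ 2) ![1, 3]
      - coord (φ 3) ![0, 3, 4] * coord (ψ 2) ![1, 2]
      + coord (φ 3) ![1, 2, 3] * coord (ψ 2) ![0, 4]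
      - coord (φ 3) ![1, 2, 4] * coord (ψ 2) ![0, 3]
      + coord (φ 3) ![1, 3, 4] * coord (ψ 2) ![0, 2]
      - coord (φ 3) ![2, 3, 4] * coord (ψ 2) ![0, 1]
      + coord (φ 4) ![0, 1, 2, 3] * coord (ψ 1) ![4]
      - coord (φ 4) ![0, 1, 2, 4] * coord (ψ 1) ![3]
      + coord (φ 4) ![0, 1, 3, 4] * coord (ψ 1) ![2]
      - coord (φ 4) ![0, 2, 3, 4] * coord (ψ 1) ![1]
      + coord (φ 4) ![1, 2, 3, 4] * coord (ψ 1) ![0]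
      + coord (φ 5) ![0, 1, 2, 3, 4] * coord (ψ 0) ![] := by
  simp only [mukai, AlternatingMap.add_apply, AlternatingMap.sub_apply]
  rw [wedge_zero_five, wedge_one_four, wedge_two_three, wedge_three_two, wedge_four_one,
    wedge_five_zero]
  ring

/-! ### The Clifford action in coordinates -/

theorem coord_add {k : ℕ} (α β : KForm k) (v : Fin k → Fin 5) :
    coord (α + β) v = coord α v + coord β v := rfl

theorem coord_smul {k : ℕ} (c : ℝ) (α : KForm k) (v : Fin k → Fin 5) :
    coord (c • α) v = c * coord α v := rfl

theorem coord_zero {k : ℕ} (v : Fin k → Fin 5) : coord (0 : KForm k) v = 0 := rfl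

theorem coord_curryLeft {k : ℕ} (α : KForm (k + 1)) (X : E5) (v : Fin k → Fin 5) :
    coord (α.curryLeft X) v = ∑ i, X i * coord α (Matrix.vecCons i v) := by
  simp only [coord_cons]
  conv_lhs => rw [← sum_smul_stdVec X, map_sum]
  simp only [map_smul, coord, ContinuousAlternatingMap.sum_apply,
    ContinuousAlternatingMap.smul_apply, smul_eq_mul]

theorem coord_covWedge {k : ℕ} (ξ : E5 →L[ℝ] ℝ) (α : KForm k) (v : Fin (k + 1) → Fin 5) :
    coord (covWedge ξ α) v =
      ∑ i : Fin (k + 1), (-1 : ℝ) ^ (i : ℕ) * (ξ (stdVec (v i)) * coord α (i.removeNth v)) :=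
  covWedge_apply ξ α _

theorem coord_covWedge_one (ξ : E5 →L[ℝ] ℝ) (α : KForm 0) (a : Fin 5) :
    coord (covWedge ξ α) ![a] = ξ (stdVec a) * coord α ![] := by
  rw [coord_covWedge]
  simp [Subsingleton.elim (Fin.removeNth (0 : Fin 1) ![a]) ![]]

theorem coord_covWedge_two (ξ : E5 →L[ℝ] ℝ) (α : KForm 1) (a b : Fin 5) :
    coord (covWedge ξ α) ![a, b] =
      ξ (stdVec a) * coord α ![b] - ξ (stdVec b) * coord α ![a] := by
  rw [coord_covWedge]
  have h0 : Fin.removeNth (0 : Fin 2) ![a, b] = ![b] := by ext1 i; fin_cases i; rfl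
  have h1 : Fin.removeNth (1 : Fin 2) ![a, b] = ![a] := by ext1 i; fin_cases i; rfl
  simp [Fin.sum_univ_succ, h0, h1]
  ring

theorem coord_covWedge_three (ξ : E5 →L[ℝ] ℝ) (α : KForm 2) (a b c : Fin 5) :
    coord (covWedge ξ α) ![a, b, c] = ξ (stdVec a) * coord α ![b, c]
      - ξ (stdVec b) * coord α ![a, c] + ξ (stdVec c) * coord α ![a, b] := by
  rw [coord_covWedge]
  have h0 : Fin.removeNth (0 : Fin 3) ![a, b, c] = ![b, c] := by ext1 i; fin_cases i <;> rfl
  have h1 : Fin.removeNth (1 : Fin 3) ![a, b, c] = ![a, c] := by ext1 i; fin_cases i <;> rfl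
  have h2 : Fin.removeNth (2 : Fin 3) ![a, b, c] = ![a, b] := by ext1 i; fin_cases i <;> rfl
  simp [Fin.sum_univ_succ, h0, h1, h2]
  ring

theorem coord_covWedge_four (ξ : E5 →L[ℝ] ℝ) (α : KForm 3) (a b c d : Fin 5) :
    coord (covWedge ξ α) ![a, b, c, d] = ξ (stdVec a) * coord α ![b, c, d]
      - ξ (stdVec b) * coord α ![a, c, d] + ξ (stdVec c) * coord α ![a, b, d]
      - ξ (stdVec d) * coord α ![a, b, c] := by
  rw [coord_covWedge]
  have h0 : Fin.removeNth (0 : Fin 4) ![a, b, c, d] = ![b, c, d] := by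
    ext1 i; fin_cases i <;> rfl
  have h1 : Fin.removeNth (1 : Fin 4) ![a, b, c, d] = ![a, c, d] := by
    ext1 i; fin_cases i <;> rfl
  have h2 : Fin.removeNth (2 : Fin 4) ![a, b, c, d] = ![a, b, d] := by
    ext1 i; fin_cases i <;> rfl
  have h3 : Fin.removeNth (3 : Fin 4) ![a, b, c, d] = ![a, b, c] := by
    ext1 i; fin_cases i <;> rfl
  simp [Fin.sum_univ_succ, h0, h1, h2, h3]
  ring

theorem coord_covWedge_five (ξ : E5 →L[ℝ] ℝ) (α : KForm 4) (a b c d e : Fin 5) :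
    coord (covWedge ξ α) ![a, b, c, d, e] = ξ (stdVec a) * coord α ![b, c, d, e]
      - ξ (stdVec b) * coord α ![a, c, d, e] + ξ (stdVec c) * coord α ![a, b, d, e]
      - ξ (stdVec d) * coord α ![a, b, c, e] + ξ (stdVec e) * coord α ![a, b, c, d] := by
  rw [coord_covWedge]
  have h0 : Fin.removeNth (0 : Fin 5) ![a, b, c, d, e] = ![b, c, d, e] := by
    ext1 i; fin_cases i <;> rfl
  have h1 : Fin.removeNth (1 : Fin 5) ![a, b, c, d, e] = ![a, c, d, e] := by
    ext1 i; fin_cases i <;> rfl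
  have h2 : Fin.removeNth (2 : Fin 5) ![a, b, c, d, e] = ![a, b, d, e] := by
    ext1 i; fin_cases i <;> rfl
  have h3 : Fin.removeNth (3 : Fin 5) ![a, b, c, d, e] = ![a, b, c, e] := by
    ext1 i; fin_cases i <;> rfl
  have h4 : Fin.removeNth (4 : Fin 5) ![a, b, c, d, e] = ![a, b, c, d] := by
    ext1 i; fin_cases i <;> rfl
  simp [Fin.sum_univ_succ, h0, h1, h2, h3, h4]
  ring

theorem coord_cliff_zero (u : GT) (φ : Forms) :
    coord (cliff u φ 0) ![] = ∑ i, u.1 i * coord (φ 1) ![i] := by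
  rw [cliff_apply_zero, coord_curryLeft]

theorem coord_cliff_one (u : GT) (φ : Forms) (a : Fin 5) :
    coord (cliff u φ 1) ![a] =
      ∑ i, u.1 i * coord (φ 2) ![i, a] + u.2 (stdVec a) * coord (φ 0) ![] := by
  rw [cliff_apply_succ, coord_add, coord_curryLeft, coord_covWedge_one]

theorem coord_cliff_two (u : GT) (φ : Forms) (a b : Fin 5) :
    coord (cliff u φ 2) ![a, b] = ∑ i, u.1 i * coord (φ 3) ![i, a, b] +
      (u.2 (stdVec a) * coord (φ 1) ![b] - u.2 (stdVec b) * coord (φ 1) ![a]) := by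
  rw [cliff_apply_succ, coord_add, coord_curryLeft, coord_covWedge_two]

theorem coord_cliff_three (u : GT) (φ : Forms) (a b c : Fin 5) :
    coord (cliff u φ 3) ![a, b, c] = ∑ i, u.1 i * coord (φ 4) ![i, a, b, c] +
      (u.2 (stdVec a) * coord (φ 2) ![b, c] - u.2 (stdVec b) * coord (φ 2) ![a, c]
        + u.2 (stdVec c) * coord (φ 2) ![a, b]) := by
  rw [cliff_apply_succ, coord_add, coord_curryLeft, coord_covWedge_three]

theorem coord_cliff_four (u : GT) (φ : Forms) (a b c d : Fin 5) :
    coord (cliff u φ 4) ![a, b, c, d] = ∑ i, u.1 i * coord (φ 5) ![i, a, b, c, d] +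
      (u.2 (stdVec a) * coord (φ 3) ![b, c, d] - u.2 (stdVec b) * coord (φ 3) ![a, c, d]
        + u.2 (stdVec c) * coord (φ 3) ![a, b, d] - u.2 (stdVec d) * coord (φ 3) ![a, b, c]) := by
  rw [cliff_apply_succ, coord_add, coord_curryLeft, coord_covWedge_four]

theorem coord_cliff_five (u : GT) (φ : Forms) (a b c d e : Fin 5) :
    coord (cliff u φ 5) ![a, b, c, d, e] = u.2 (stdVec a) * coord (φ 4) ![b, c, d, e]
      - u.2 (stdVec b) * coord (φ 4) ![a, c, d, e] + u.2 (stdVec c) * coord (φ 4) ![a, b, d, e]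
      - u.2 (stdVec d) * coord (φ 4) ![a, b, c, e]
      + u.2 (stdVec e) * coord (φ 4) ![a, b, c, d] := by
  rw [cliff_apply_succ, kform_eq_zero_of_five_lt (by decide) (φ (4 + 2)), coord_add,
    coord_covWedge_five, ContinuousAlternatingMap.curryLeft_zero, _root_.zero_apply, coord_zero,
    zero_add]

/-! ### The Mukai pairing as a bilinear form -/

/-- The Mukai pairing, evaluated on the standard basis. -/
def mukaiForm : Forms →ₗ[ℝ] Forms →ₗ[ℝ] ℝ :=
  LinearMap.mk₂ ℝ (fun φ ψ => mukai φ ψ stdVec)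
    (fun _ _ _ => by simp only [mukai_stdVec, Pi.add_apply, coord_add]; ring)
    (fun _ _ _ => by simp only [mukai_stdVec, Pi.smul_apply, coord_smul, smul_eq_mul]; ring)
    (fun _ _ _ => by simp only [mukai_stdVec, Pi.add_apply, coord_add]; ring)
    (fun _ _ _ => by simp only [mukai_stdVec, Pi.smul_apply, coord_smul, smul_eq_mul]; ring)

theorem mukaiForm_apply (φ ψ : Forms) : mukaiForm φ ψ = mukai φ ψ stdVec := rfl

theorem mukaiForm_comm (φ ψ : Forms) : mukaiForm φ ψ = mukaiForm ψ φ := by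
  simp only [mukaiForm_apply, mukai_stdVec]
  ring

/-- Vectors of `T ⊕ T*` are self-adjoint for the Mukai pairing. -/
theorem mukaiForm_cliff (u : GT) (φ ψ : Forms) :
    mukaiForm (cliff u φ) ψ = mukaiForm φ (cliff u ψ) := by
  simp only [mukaiForm_apply, mukai_stdVec, coord_cliff_zero, coord_cliff_one, coord_cliff_two,
    coord_cliff_three, coord_cliff_four, coord_cliff_five, Fin.sum_univ_five]
  simp [coord_self₀, coord_self₁, coord_self₂, coord_self₃, coord_swap₀, coord_swap₁,
    coord_swap₂, coord_swap₃, -Fin.zero_eta]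
  ring

/-- The quadratic map `Q` on even forms, in coordinates. -/
theorem mukaiForm_cliff_self {φ : Forms} (hφ : φ ∈ evenForms) (u : GT) :
    mukaiForm (cliff u φ) φ = 2 * (u.1 0 * (-coord (φ 2) ![0, 1] * coord (φ 4) ![0, 2, 3, 4]
          + coord (φ 2) ![0, 4] * coord (φ 4) ![0, 1, 2, 3]
          - coord (φ 2) ![0, 3] * coord (φ 4) ![0, 1, 2, 4]
          + coord (φ 2) ![0, 2] * coord (φ 4) ![0, 1, 3, 4])
      + u.1 1 * (-coord (φ 2) ![0, 1] * coord (φ 4) ![1, 2, 3, 4]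
          + coord (φ 2) ![1, 4] * coord (φ 4) ![0, 1, 2, 3]
          - coord (φ 2) ![1, 3] * coord (φ 4) ![0, 1, 2, 4]
          + coord (φ 2) ![1, 2] * coord (φ 4) ![0, 1, 3, 4])
      + u.1 2 * (coord (φ 2) ![2, 4] * coord (φ 4) ![0, 1, 2, 3]
          - coord (φ 2) ![2, 3] * coord (φ 4) ![0, 1, 2, 4]
          - coord (φ 2) ![0, 2] * coord (φ 4) ![1, 2, 3, 4]
          + coord (φ 2) ![1, 2] * coord (φ 4) ![0, 2, 3, 4])
      + u.1 3 * (coord (φ 2) ![3, 4] * coord (φ 4) ![0, 1, 2, 3]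
          - coord (φ 2) ![2, 3] * coord (φ 4) ![0, 1, 3, 4]
          + coord (φ 2) ![1, 3] * coord (φ 4) ![0, 2, 3, 4]
          - coord (φ 2) ![0, 3] * coord (φ 4) ![1, 2, 3, 4])
      + u.1 4 * (coord (φ 2) ![3, 4] * coord (φ 4) ![0, 1, 2, 4]
          - coord (φ 2) ![2, 4] * coord (φ 4) ![0, 1, 3, 4]
          + coord (φ 2) ![1, 4] * coord (φ 4) ![0, 2, 3, 4]
          - coord (φ 2) ![0, 4] * coord (φ 4) ![1, 2, 3, 4])
      + u.2 (stdVec 0) * (coord (φ 0) ![] * coord (φ 4) ![1, 2, 3, 4]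
          - coord (φ 2) ![1, 2] * coord (φ 2) ![3, 4]
          + coord (φ 2) ![1, 3] * coord (φ 2) ![2, 4]
          - coord (φ 2) ![1, 4] * coord (φ 2) ![2, 3])
      + u.2 (stdVec 1) * (-coord (φ 0) ![] * coord (φ 4) ![0, 2, 3, 4]
          + coord (φ 2) ![0, 2] * coord (φ 2) ![3, 4]
          - coord (φ 2) ![0, 3] * coord (φ 2) ![2, 4]
          + coord (φ 2) ![0, 4] * coord (φ 2) ![2, 3])
      + u.2 (stdVec 2) * (coord (φ 0) ![] * coord (φ 4) ![0, 1, 3, 4]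
          - coord (φ 2) ![0, 1] * coord (φ 2) ![3, 4]
          + coord (φ 2) ![0, 3] * coord (φ 2) ![1, 4]
          - coord (φ 2) ![0, 4] * coord (φ 2) ![1, 3])
      + u.2 (stdVec 3) * (-coord (φ 0) ![] * coord (φ 4) ![0, 1, 2, 4]
          + coord (φ 2) ![0, 1] * coord (φ 2) ![2, 4]
          - coord (φ 2) ![0, 2] * coord (φ 2) ![1, 4]
          + coord (φ 2) ![0, 4] * coord (φ 2) ![1, 2])
      + u.2 (stdVec 4) * (coord (φ 0) ![] * coord (φ 4) ![0, 1, 2, 3]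
          - coord (φ 2) ![0, 1] * coord (φ 2) ![2, 3]
          + coord (φ 2) ![0, 2] * coord (φ 2) ![1, 3]
          - coord (φ 2) ![0, 3] * coord (φ 2) ![1, 2])) := by
  have h1 : φ 1 = 0 := hφ 1 (by decide)
  have h3 : φ 3 = 0 := hφ 3 (by decide)
  have h5 : φ 5 = 0 := hφ 5 (by decide)
  simp only [mukaiForm_apply, mukai_stdVec, coord_cliff_zero, coord_cliff_one, coord_cliff_two,
    coord_cliff_three, coord_cliff_four, coord_cliff_five, Fin.sum_univ_five, h1, h3, h5,
    coord_zero]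
  simp [coord_self₀, coord_self₁, coord_self₂, coord_swap₀, coord_swap₁, coord_swap₂]
  ring

/-! ### The spinor square -/

theorem pairing_apply (u w : GT) : pairing u w = (u.2 w.1 + w.2 u.1) / 2 := rfl

theorem pairing_comm (u w : GT) : pairing u w = pairing w u := by
  rw [pairing_apply, pairing_apply, add_comm]

theorem pairing_stdVec (u : GT) (i : Fin 5) : pairing u (stdVec i, 0) = u.2 (stdVec i) / 2 := by
  simp [pairing_apply]

theorem pairing_stdCovec (u : GT) (i : Fin 5) : pairing u (0, stdCovec i) = u.1 i / 2 := by
  simp [pairing_apply, stdCovec]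

/-- The inner product on `T ⊕ T*` is non-degenerate. -/
theorem eq_of_pairing_eq {u w : GT} (h : ∀ v, pairing u v = pairing w v) : u = w := by
  refine Prod.ext ?_ ?_
  · ext i
    have := h (0, stdCovec i)
    rw [pairing_stdCovec, pairing_stdCovec] at this
    linarith
  · rw [← sum_smul_stdCovec u.2, ← sum_smul_stdCovec w.2]
    refine Finset.sum_congr rfl fun i _ => ?_
    have := h (stdVec i, 0)
    rw [pairing_stdVec, pairing_stdVec] at this
    rw [show u.2 (stdVec i) = w.2 (stdVec i) by linarith]

theorem sum_stdVec_add_sum_stdCovec (u : GT) :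
    ∑ i, u.1 i • ((stdVec i, 0) : GT) + ∑ i, u.2 (stdVec i) • ((0, stdCovec i) : GT) = u := by
  refine Prod.ext ?_ ?_
  · simp [Prod.fst_sum, sum_smul_stdVec]
  · simp [Prod.snd_sum, sum_smul_stdCovec]

theorem spinorVec_fst (ν : KForm 5) (φ ψ : Forms) (i : Fin 5) :
    (spinorVec ν φ ψ).1 i = 2 * (mukaiForm (cliff (0, stdCovec i) φ) ψ / ν stdVec) := by
  have h : (spinorVec ν φ ψ).1 =
    ∑ i, (2 * ratio (mukai (cliff (0, stdCovec i) φ) ψ) ν) • stdVec i := rfl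
  rw [h]
  simp [stdVec, ratio, mukaiForm_apply, Pi.single_apply]

theorem spinorVec_snd (ν : KForm 5) (φ ψ : Forms) (i : Fin 5) :
    (spinorVec ν φ ψ).2 (stdVec i) = 2 * (mukaiForm (cliff (stdVec i, 0) φ) ψ / ν stdVec) := by
  have h : (spinorVec ν φ ψ).2 =
    ∑ i, (2 * ratio (mukai (cliff (stdVec i, 0) φ) ψ) ν) • stdCovec i := rfl
  rw [h]
  simp [stdCovec_stdVec, ratio, mukaiForm_apply]

/-- The defining property `(P(φ, ψ), v) = ⟨v · φ, ψ⟩`, divided by `ν`. -/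
theorem pairing_spinorVec (ν : KForm 5) (φ ψ : Forms) (v : GT) :
    pairing (spinorVec ν φ ψ) v = mukaiForm (cliff v φ) ψ / ν stdVec := by
  conv_lhs => rw [← sum_stdVec_add_sum_stdCovec v]
  conv_rhs => rw [← sum_stdVec_add_sum_stdCovec v]
  simp only [map_add, map_sum, map_smul, LinearMap.add_apply, LinearMap.sum_apply,
    LinearMap.smul_apply, pairing_stdVec, pairing_stdCovec, spinorVec_fst, spinorVec_snd,
    smul_eq_mul, add_div, Finset.sum_div]
  congr 1 <;> exact Finset.sum_congr rfl fun i _ => by ring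

theorem spinorVec_comm (ν : KForm 5) (φ ψ : Forms) : spinorVec ν φ ψ = spinorVec ν ψ φ :=
  eq_of_pairing_eq fun v => by
    rw [pairing_spinorVec, pairing_spinorVec, mukaiForm_cliff, mukaiForm_comm]

theorem spinorVec_add_left (ν : KForm 5) (φ φ' ψ : Forms) :
    spinorVec ν (φ + φ') ψ = spinorVec ν φ ψ + spinorVec ν φ' ψ :=
  eq_of_pairing_eq fun v => by
    simp only [pairing_spinorVec, map_add, LinearMap.add_apply, add_div]

theorem spinorVec_smul_left (ν : KForm 5) (c : ℝ) (φ ψ : Forms) :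
    spinorVec ν (c • φ) ψ = c • spinorVec ν φ ψ :=
  eq_of_pairing_eq fun v => by
    simp only [pairing_spinorVec, map_smul, LinearMap.smul_apply, smul_eq_mul, mul_div_assoc]

theorem spinorVec_add_right (ν : KForm 5) (φ ψ ψ' : Forms) :
    spinorVec ν φ (ψ + ψ') = spinorVec ν φ ψ + spinorVec ν φ ψ' := by
  simp only [spinorVec_comm ν φ, spinorVec_add_left]

theorem spinorVec_smul_right (ν : KForm 5) (c : ℝ) (φ ψ : Forms) :
    spinorVec ν φ (c • ψ) = c • spinorVec ν φ ψ := by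
  simp only [spinorVec_comm ν φ, spinorVec_smul_left]

theorem strictMono_fin_five_three {v : Fin 3 → Fin 5} (hv : StrictMono v) :
    ∃ a b c, a < b ∧ b < c ∧ v = ![a, b, c] :=
  ⟨v 0, v 1, v 2, hv (by decide), hv (by decide), by ext1 i; fin_cases i <;> rfl⟩

theorem strictMono_fin_five_five {v : Fin 5 → Fin 5} (hv : StrictMono v) :
    v = ![0, 1, 2, 3, 4] := by
  have h01 : v 0 < v 1 := hv (by decide)
  have h12 : v 1 < v 2 := hv (by decide)
  have h23 : v 2 < v 3 := hv (by decide)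
  have h34 : v 3 < v 4 := hv (by decide)
  ext i
  fin_cases i <;> simp <;> omega

/-- The Fierz identity `Q(φ) · φ = 0` for even forms `φ`. -/
theorem cliff_spinorSq_self (ν : KForm 5) {φ : Forms} (hφ : φ ∈ evenForms) :
    cliff (spinorSq ν φ) φ = 0 := by
  have h1 : φ 1 = 0 := hφ 1 (by decide)
  have h3 : φ 3 = 0 := hφ 3 (by decide)
  have h5 : φ 5 = 0 := hφ 5 (by decide)
  funext k
  obtain hk | hk := lt_or_ge 5 k
  · rw [kform_eq_zero_of_five_lt hk (cliff _ _ _), Pi.zero_apply]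
  refine kform_ext fun v hv => ?_
  simp only [Pi.zero_apply, coord_zero]
  have hX : ∀ i, (spinorSq ν φ).1 i = _ := fun i => spinorVec_fst ν φ φ i
  have hξ : ∀ i, (spinorSq ν φ).2 (stdVec i) = _ := fun i => spinorVec_snd ν φ φ i
  interval_cases k
  · rw [Subsingleton.elim v ![], coord_cliff_zero, h1]
    simp [coord_zero]
  · rw [show v = ![v 0] by ext1 i; fin_cases i; rfl, coord_cliff_one]
    generalize v 0 = a
    simp only [hX, hξ, Fin.sum_univ_five, mukaiForm_cliff_self hφ, stdCovec_stdVec]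
    fin_cases a <;> simp [coord_self₀, coord_swap₀, stdVec] <;> ring
  · rw [show v = ![v 0, v 1] by ext1 i; fin_cases i <;> rfl, coord_cliff_two, h1, h3]
    simp [coord_zero]
  · obtain ⟨a, b, c, hab, hbc, rfl⟩ := strictMono_fin_five_three hv
    rw [coord_cliff_three]
    simp only [hX, hξ, Fin.sum_univ_five, mukaiForm_cliff_self hφ, stdCovec_stdVec]
    fin_cases a <;> fin_cases b <;> simp at hab <;> fin_cases c <;> simp at hbc <;>
      simp [coord_self₀, coord_self₁, coord_self₂, coord_swap₀, coord_swap₁, coord_swap₂,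
        stdVec] <;> ring
  · rw [show v = ![v 0, v 1, v 2, v 3] by ext1 i; fin_cases i <;> rfl, coord_cliff_four, h3, h5]
    simp [coord_zero]
  · rw [strictMono_fin_five_five hv, coord_cliff_five]
    simp only [hξ, mukaiForm_cliff_self hφ]
    simp [stdVec]
    ring

/-! ### Parity and the polarised Fierz identities -/

theorem cliff_mem_oddForms (u : GT) {φ : Forms} (hφ : φ ∈ evenForms) :
    cliff u φ ∈ oddForms := by
  intro k hk
  cases k with
  | zero =>
    rw [cliff_apply_zero, hφ 1 (by decide), ContinuousAlternatingMap.curryLeft_zero]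
    rfl
  | succ k =>
    have h1 : Odd k := by grind
    rw [cliff_apply_succ, hφ k h1, hφ (k + 2) (by grind),
      ContinuousAlternatingMap.curryLeft_zero]
    ext v
    simp [covWedge_apply]

theorem cliff_mem_evenForms (u : GT) {φ : Forms} (hφ : φ ∈ oddForms) :
    cliff u φ ∈ evenForms := by
  intro k hk
  cases k with
  | zero => simp at hk
  | succ k =>
    have h1 : Even k := by grind
    rw [cliff_apply_succ, hφ k h1, hφ (k + 2) (by grind),
      ContinuousAlternatingMap.curryLeft_zero]
    ext v
    simp [covWedge_apply]

theorem spinorSq_add_smul (ν : KForm 5) (φ ψ : Forms) (z : ℝ) :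
    spinorSq ν (φ + z • ψ) =
      spinorSq ν φ + (2 * z) • spinorVec ν φ ψ + z ^ 2 • spinorSq ν ψ := by
  simp only [spinorSq, spinorVec_add_left, spinorVec_add_right, spinorVec_smul_left,
    spinorVec_smul_right, spinorVec_comm ν ψ φ]
  module

/-- The coefficient of `z` in the Fierz identity for `φ + zψ`. -/
theorem cliff_spinorSq_add_cliff_spinorVec (ν : KForm 5) {φ ψ : Forms} (hφ : φ ∈ evenForms)
    (hψ : ψ ∈ evenForms) :
    cliff (spinorSq ν φ) ψ + (2 : ℝ) • cliff (spinorVec ν φ ψ) φ = 0 := by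
  have h (z : ℝ) : cliff (spinorSq ν (φ + z • ψ)) (φ + z • ψ) = 0 :=
    cliff_spinorSq_self ν (evenForms.add_mem hφ (evenForms.smul_mem z hψ))
  have h1 := h 1
  have h2 := h (-1)
  simp only [spinorSq_add_smul, map_add, map_smul, LinearMap.add_apply, LinearMap.smul_apply,
    cliff_spinorSq_self ν hφ, cliff_spinorSq_self ν hψ] at h1 h2
  have h3 := congrArg (fun x => (1 / 2 : ℝ) • x) (h1.trans h2.symm)
  rw [← sub_eq_zero] at h3
  rw [← h3]
  module

theorem pairing_spinorSq_self (ν : KForm 5) {φ : Forms} (hφ : φ ∈ evenForms) :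
    pairing (spinorSq ν φ) (spinorSq ν φ) = 0 := by
  conv_lhs => arg 1; rw [spinorSq]
  rw [pairing_spinorVec, cliff_spinorSq_self ν hφ]
  simp

theorem pairing_spinorSq_spinorVec (ν : KForm 5) {φ : Forms} (ψ : Forms) (hφ : φ ∈ evenForms) :
    pairing (spinorSq ν φ) (spinorVec ν φ ψ) = 0 := by
  rw [pairing_comm, pairing_spinorVec, cliff_spinorSq_self ν hφ]
  simp

theorem pairing_spinorVec_self (ν : KForm 5) {φ ψ : Forms} (hφ : φ ∈ evenForms)
    (hψ : ψ ∈ evenForms) :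
    pairing (spinorVec ν φ ψ) (spinorVec ν φ ψ) =
      -(1 / 2) * pairing (spinorSq ν φ) (spinorSq ν ψ) := by
  have h := cliff_spinorSq_add_cliff_spinorVec ν hφ hψ
  have h1 : cliff (spinorVec ν φ ψ) φ = (-(1 / 2 : ℝ)) • cliff (spinorSq ν φ) ψ := by
    rw [← sub_eq_zero]
    have := congrArg (fun x => (1 / 2 : ℝ) • x) h
    simp only [smul_zero] at this
    rw [← this]
    module
  rw [pairing_spinorVec, h1, pairing_comm (spinorSq ν φ)]
  conv_rhs => arg 2; arg 1; rw [spinorSq]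
  rw [pairing_spinorVec]
  simp
  ring

/-! ### The quartic -/

/-- The constant function `1`, as a non-homogeneous form. -/
def oneForms : Forms
  | 0 => .constOfIsEmpty ℝ E5 (Fin 0) 1
  | _ + 1 => 0

theorem oneForms_mem : oneForms ∈ evenForms := by
  intro k hk
  cases k with
  | zero => simp at hk
  | succ k => rfl

theorem coord_oneForms_zero : coord (oneForms 0) ![] = 1 := by
  simp [coord, oneForms]

theorem oneForms_succ (k : ℕ) : oneForms (k + 1) = 0 := rfl

/-- Clifford multiplication by the `i`-th standard covector. -/
abbrev cov (i : Fin 5) : Forms →ₗ[ℝ] Forms := cliff (0, stdCovec i)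

theorem stdVec_apply (i j : Fin 5) : stdVec i j = if j = i then 1 else 0 := by
  simp [stdVec]

theorem stdVec_ne_zero_of_ne_zero {ν : KForm 5} (hν : ν ≠ 0) : ν stdVec ≠ 0 := by
  intro h
  refine hν (kform_ext fun v hv => ?_)
  rw [strictMono_fin_five_five hv]
  rw [coord_zero, ← h, coord]
  congr 1
  ext1 i
  fin_cases i <;> rfl

/-- The quartic is not identically zero. -/
theorem exists_quartic_ne_zero {ν : KForm 5} (hν : ν ≠ 0) :
    ∃ r : Fin 2 → Forms, (∀ i, r i ∈ evenForms) ∧ quartic ν r ≠ 0 := by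
  have hν' := stdVec_ne_zero_of_ne_zero hν
  have h2 (i j : Fin 5) : cov i (cov j oneForms) ∈ evenForms :=
    cliff_mem_evenForms _ (cliff_mem_oddForms _ oneForms_mem)
  have h4 (i j k l : Fin 5) : cov i (cov j (cov k (cov l oneForms))) ∈ evenForms :=
    cliff_mem_evenForms _ (cliff_mem_oddForms _ (h2 k l))
  -- two forms `a`, `b` with few non-zero coordinates, for which `(Q(a), Q(b)) ≠ 0`
  set a : Forms := oneForms + cov 1 (cov 2 (cov 3 (cov 4 oneForms))) with ha
  set b : Forms := cov 0 (cov 1 oneForms) + cov 0 (cov 2 (cov 3 (cov 4 oneForms))) with hb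
  have hae : a ∈ evenForms := evenForms.add_mem oneForms_mem (h4 _ _ _ _)
  have hbe : b ∈ evenForms := evenForms.add_mem (h2 _ _) (h4 _ _ _ _)
  refine ⟨![a, b], fun i => by fin_cases i <;> assumption, ?_⟩
  have h0 : quartic ν ![a, b] = pairing (spinorVec ν a a) (spinorSq ν b) := rfl
  rw [h0, pairing_spinorVec, mukaiForm_cliff_self hae]
  have hξ : (spinorSq ν b).2 (stdVec 0) = _ := spinorVec_snd ν b b 0
  rw [hξ, mukaiForm_cliff_self hbe]
  simp [ha, hb, coord_add, coord_cliff_zero, coord_cliff_one, coord_cliff_two, coord_cliff_three,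
    coord_cliff_four, oneForms_succ, coord_zero, coord_oneForms_zero,
    stdVec_apply, stdCovec_stdVec, hν']

/-- The Mukai pairing between odd and even forms is non-degenerate. -/
theorem eq_zero_of_mukaiForm_eq_zero {s : Forms} (hs : s ∈ oddForms)
    (h : ∀ t ∈ evenForms, mukaiForm s t = 0) : s = 0 := by
  -- up to a sign, each coordinate of `s` is the pairing of `s` with a product of covectors
  have key (φ : Forms) : mukaiForm φ oneForms = coord (φ 5) ![0, 1, 2, 3, 4] := by
    simp [mukaiForm_apply, mukai_stdVec, oneForms_succ, coord_zero, coord_oneForms_zero]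
  have e2 (i j : Fin 5) : cov i (cov j oneForms) ∈ evenForms :=
    cliff_mem_evenForms _ (cliff_mem_oddForms _ oneForms_mem)
  have h5 := h _ oneForms_mem
  have h3 (i j : Fin 5) := h _ (e2 i j)
  have h1 (i j k l : Fin 5) := h _ (cliff_mem_evenForms (0, stdCovec i)
    (cliff_mem_oddForms (0, stdCovec j) (e2 k l)))
  simp only [← mukaiForm_cliff, key, coord_cliff_five, coord_cliff_four, coord_cliff_three,
    coord_cliff_two, stdCovec_stdVec] at h5 h3 h1
  funext k
  obtain hk | hk := lt_or_ge 5 k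
  · exact kform_eq_zero_of_five_lt hk _
  refine kform_ext fun v hv => ?_
  rw [Pi.zero_apply, coord_zero]
  interval_cases k
  · rw [hs 0 (by decide), coord_zero]
  · rw [show v = ![v 0] by ext1 i; fin_cases i; rfl]
    generalize v 0 = a
    fin_cases a
    · simpa using h1 1 2 3 4
    · simpa using h1 0 2 3 4
    · simpa using h1 0 1 3 4
    · simpa using h1 0 1 2 4
    · simpa using h1 0 1 2 3
  · rw [hs 2 (by decide), coord_zero]
  · obtain ⟨a, b, c, hab, hbc, rfl⟩ := strictMono_fin_five_three hv
    fin_cases a <;> fin_cases b <;> simp at hab <;> fin_cases c <;> simp at hbc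
    · simpa using h3 3 4
    · simpa using h3 2 4
    · simpa using h3 2 3
    · simpa using h3 1 4
    · simpa using h3 1 3
    · simpa using h3 1 2
    · simpa using h3 0 4
    · simpa using h3 0 3
    · simpa using h3 0 2
    · simpa using h3 0 1
  · rw [hs 4 (by decide), coord_zero]
  · rw [strictMono_fin_five_five hv, h5]

/-! ### Invariance of the quartic and stability -/

theorem cliffordRep_ι (u : GT) (φ : Forms) :
    cliffordRep (CliffordAlgebra.ι quad u) φ = cliff u φ := by
  simp [cliffordRep]

open CliffordAlgebra in
/-- For the Mukai pairing, reversal in the Clifford algebra is the adjoint. -/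
theorem mukaiForm_cliffordRep (x : CliffordAlgebra quad) (φ ψ : Forms) :
    mukaiForm (cliffordRep x φ) ψ = mukaiForm φ (cliffordRep (reverse x) ψ) := by
  induction x using CliffordAlgebra.induction generalizing φ ψ with
  | algebraMap r =>
    have h (χ : Forms) : cliffordRep (algebraMap ℝ _ r) χ = r • χ := by
      rw [AlgHom.commutes, Module.algebraMap_end_apply]
    rw [reverse.commutes, h, h]
    simp only [map_smul, LinearMap.smul_apply]
  | ι u =>
    rw [reverse_ι, cliffordRep_ι, cliffordRep_ι]
    exact mukaiForm_cliff u φ ψ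
  | mul a b ha hb =>
    rw [reverse.map_mul, map_mul, map_mul, Module.End.mul_apply, Module.End.mul_apply, ha, hb]
  | add a b ha hb =>
    rw [map_add, map_add, map_add, LinearMap.add_apply, LinearMap.add_apply, map_add, map_add,
      LinearMap.add_apply, ha, hb]

theorem star_eq_reverse_of_mem_spinGroup {g : CliffordAlgebra quad} (hg : g ∈ spinGroup quad) :
    star g = CliffordAlgebra.reverse g := by
  rw [CliffordAlgebra.star_def, spinGroup.involute_eq hg]

/-- A spin group element acts on `T ⊕ T*` by conjugation. -/
theorem exists_star_mul_ι_mul {g : CliffordAlgebra quad} (hg : g ∈ spinGroup quad) (v : GT) :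
    ∃ w, star g * CliffordAlgebra.ι quad v * g = CliffordAlgebra.ι quad w := by
  have hs := spinGroup.star_mem hg
  let x : (CliffordAlgebra quad)ˣ := ⟨star g, g, spinGroup.star_mul_self_of_mem hg,
    spinGroup.mul_star_self_of_mem hg⟩
  have : Invertible (2 : ℝ) := invertibleOfNonzero two_ne_zero
  obtain ⟨w, hw⟩ := spinGroup.conjAct_smul_ι_mem_range_ι (x := x) hs v
  exact ⟨w, by rw [hw, ConjAct.units_smul_def]; rfl⟩

theorem quad_eq_pairing (u : GT) : quad u = pairing u u := rfl

theorem polar_quad (u w : GT) : QuadraticMap.polar quad u w = 2 * pairing u w := by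
  simp only [QuadraticMap.polar, quad_eq_pairing, map_add, LinearMap.add_apply, pairing_comm w u]
  ring

/-- The polarised Clifford identity. -/
theorem cliff_cliff_add_swap (u w : GT) (φ : Forms) :
    cliff u (cliff w φ) + cliff w (cliff u φ) = (2 * pairing u w) • φ := by
  have e : (2 * pairing u w) • φ = quad (u + w) • φ - quad u • φ - quad w • φ := by
    rw [← polar_quad, QuadraticMap.polar]
    module
  rw [e, ← cliff_cliff, ← cliff_cliff, ← cliff_cliff]
  simp only [map_add, LinearMap.add_apply]
  abel

/-- Conjugation by a spin group element preserves the inner product. -/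
theorem pairing_eq_of_conj {g : CliffordAlgebra quad} (hg : g ∈ spinGroup quad) {v w v' w' : GT}
    (hv : star g * CliffordAlgebra.ι quad v * g = CliffordAlgebra.ι quad v')
    (hw : star g * CliffordAlgebra.ι quad w * g = CliffordAlgebra.ι quad w') :
    pairing v' w' = pairing v w := by
  have hg' := spinGroup.mul_star_self_of_mem hg
  have key {a b a' b' : GT}
      (ha : star g * CliffordAlgebra.ι quad a * g = CliffordAlgebra.ι quad a')
      (hb : star g * CliffordAlgebra.ι quad b * g = CliffordAlgebra.ι quad b') :
      CliffordAlgebra.ι quad a' * CliffordAlgebra.ι quad b' =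
        star g * (CliffordAlgebra.ι quad a * CliffordAlgebra.ι quad b) * g := by
    rw [← ha, ← hb]
    calc _ = star g * CliffordAlgebra.ι quad a * (g * star g) * CliffordAlgebra.ι quad b * g := by
          simp only [mul_assoc]
      _ = _ := by rw [hg']; simp only [mul_assoc, one_mul]
  have h1 := CliffordAlgebra.ι_mul_ι_add_swap (Q := quad) v' w'
  rw [key hv hw, key hw hv, ← add_mul, ← mul_add, CliffordAlgebra.ι_mul_ι_add_swap,
    ← Algebra.commutes, mul_assoc, spinGroup.star_mul_self_of_mem hg, mul_one] at h1
  -- both sides of `h1` are scalars, which the action on the form `1` detects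
  have h2 := congrArg (fun x => coord (cliffordRep x oneForms 0) ![]) h1
  simp only [AlgHom.commutes, Module.algebraMap_end_apply, Pi.smul_apply, coord_smul,
    polar_quad, coord_oneForms_zero] at h2
  linarith

/-- The spinor square is equivariant under the spin group. -/
theorem pairing_spinorSq_cliffordRep {g : CliffordAlgebra quad} (hg : g ∈ spinGroup quad)
    (ν : KForm 5) (φ : Forms) {v v' : GT}
    (hv : star g * CliffordAlgebra.ι quad v * g = CliffordAlgebra.ι quad v') :
    pairing (spinorSq ν (cliffordRep g φ)) v = pairing (spinorSq ν φ) v' := by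
  rw [spinorSq, spinorSq, pairing_spinorVec, pairing_spinorVec, ← cliffordRep_ι, ← cliffordRep_ι,
    ← hv, mukaiForm_comm, mukaiForm_comm _ φ, mukaiForm_cliffordRep,
    ← star_eq_reverse_of_mem_spinGroup hg]
  simp only [map_mul, Module.End.mul_apply]

/-- The quartic is invariant under the spin group. -/
theorem quartic_cliffordRep {g : CliffordAlgebra quad} (hg : g ∈ spinGroup quad)
    (ν : KForm 5) (φ ψ : Forms) :
    pairing (spinorSq ν (cliffordRep g φ)) (spinorSq ν (cliffordRep g ψ)) =
      pairing (spinorSq ν φ) (spinorSq ν ψ) := by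
  obtain ⟨w, hw⟩ := exists_star_mul_ι_mul hg (spinorSq ν (cliffordRep g ψ))
  have h : w = spinorSq ν ψ := by
    refine eq_of_pairing_eq fun v' => ?_
    -- every vector is the conjugate of a vector, because `star g` is a spin group element too
    obtain ⟨v, hv⟩ := exists_star_mul_ι_mul (spinGroup.star_mem hg) v'
    have hv' : star g * CliffordAlgebra.ι quad v * g = CliffordAlgebra.ι quad v' := by
      rw [← hv, star_star]
      calc _ = (star g * g) * CliffordAlgebra.ι quad v' * (star g * g) := by
            simp only [mul_assoc]
        _ = _ := by rw [spinGroup.star_mul_self_of_mem hg, one_mul, mul_one]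
    rw [pairing_eq_of_conj hg hw hv', pairing_spinorSq_cliffordRep hg ν ψ hv']
  rw [pairing_spinorSq_cliffordRep hg ν φ hw, h]

/-- The quartic is multiplied by `det²` under the action of `GL(2, ℝ)`. -/
theorem pairing_spinorSq_smul_add_smul (ν : KForm 5) {φ ψ : Forms} (hφ : φ ∈ evenForms)
    (hψ : ψ ∈ evenForms) (a b c d : ℝ) :
    pairing (spinorSq ν (a • φ + b • ψ)) (spinorSq ν (c • φ + d • ψ)) =
      (a * d - b * c) ^ 2 * pairing (spinorSq ν φ) (spinorSq ν ψ) := by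
  have h1 := pairing_spinorSq_self ν hφ
  have h2 := pairing_spinorSq_self ν hψ
  have h3 := pairing_spinorSq_spinorVec ν ψ hφ
  have h4 := pairing_spinorSq_spinorVec ν φ hψ
  have h5 := pairing_spinorVec_self ν hφ hψ
  rw [spinorVec_comm] at h4
  have key (x y : ℝ) : spinorSq ν (x • φ + y • ψ) =
      x ^ 2 • spinorSq ν φ + (2 * x * y) • spinorVec ν φ ψ + y ^ 2 • spinorSq ν ψ := by
    simp only [spinorSq, spinorVec_add_left, spinorVec_add_right, spinorVec_smul_left,
      spinorVec_smul_right, spinorVec_comm ν ψ φ]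
    module
  rw [key, key]
  simp only [map_add, map_smul, LinearMap.add_apply, LinearMap.smul_apply, smul_eq_mul,
    pairing_comm (spinorVec ν φ ψ) (spinorSq ν _), pairing_comm (spinorSq ν ψ) (spinorSq ν φ),
    h1, h2, h3, h4, h5]
  ring

/-- Along a line in the space of pairs, the quartic is a polynomial. -/
theorem exists_quartic_add_smul (ν : KForm 5) (r t : Fin 2 → Forms) :
    ∃ c₁ c₂ c₃ c₄ : ℝ,
      c₁ = 2 * (mukaiForm (cliff (spinorSq ν (r 1)) (r 0)) (t 0) / ν stdVec +
        mukaiForm (cliff (spinorSq ν (r 0)) (r 1)) (t 1) / ν stdVec) ∧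
      ∀ z : ℝ, quartic ν (r + z • t) =
        quartic ν r + c₁ * z + c₂ * z ^ 2 + c₃ * z ^ 3 + c₄ * z ^ 4 := by
  refine ⟨_, pairing (spinorSq ν (t 0)) (spinorSq ν (r 1))
      + 4 * pairing (spinorVec ν (r 0) (t 0)) (spinorVec ν (r 1) (t 1))
      + pairing (spinorSq ν (r 0)) (spinorSq ν (t 1)),
    2 * pairing (spinorSq ν (t 0)) (spinorVec ν (r 1) (t 1))
      + 2 * pairing (spinorVec ν (r 0) (t 0)) (spinorSq ν (t 1)),
    pairing (spinorSq ν (t 0)) (spinorSq ν (t 1)), rfl, fun z => ?_⟩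
  rw [← pairing_spinorVec, ← pairing_spinorVec, pairing_comm _ (spinorSq ν (r 0))]
  simp only [quartic, Pi.add_apply, Pi.smul_apply, spinorSq_add_smul]
  simp
  ring

/-- The quartic does not vanish on an open orbit: otherwise it would vanish on an open set, hence
identically. -/
theorem IsStable.quartic_ne_zero {ν : KForm 5} (hν : ν ≠ 0) {r : Fin 2 → Forms}
    (hr : IsStable r) : quartic ν r ≠ 0 := by
  intro h0
  obtain ⟨hev, hopen⟩ := hr
  have horbit : ∀ s ∈ orbit r, quartic ν (fun i => (s i : Forms)) = 0 := by
    rintro s ⟨g, hg, A, hs⟩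
    have e (i : Fin 2) : (s i : Forms) = cliffordRep g (A.1 i 0 • r 0 + A.1 i 1 • r 1) := by
      rw [hs i, Fin.sum_univ_two]
      simp
    have h1 : quartic ν (fun i => (s i : Forms)) =
        pairing (spinorSq ν (s 0 : Forms)) (spinorSq ν (s 1 : Forms)) := rfl
    rw [h1, e, e, quartic_cliffordRep hg, pairing_spinorSq_smul_add_smul ν (hev 0) (hev 1)]
    rw [quartic] at h0
    rw [h0, mul_zero]
  obtain ⟨q, hq, hq0⟩ := exists_quartic_ne_zero hν
  -- on the line from `r` to a pair `q` with non-zero quartic, the quartic is a polynomial that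
  -- vanishes near `r`
  obtain ⟨p, hp⟩ : ∃ p : Polynomial ℝ, ∀ z, quartic ν (r + z • (q - r)) = p.eval z := by
    open Polynomial in
    obtain ⟨c₁, c₂, c₃, c₄, -, hc⟩ := exists_quartic_add_smul ν r (q - r)
    exact ⟨C (quartic ν r) + C c₁ * X + C c₂ * X ^ 2 + C c₃ * X ^ 3 + C c₄ * X ^ 4, fun z => by
      rw [hc]; simp⟩
  have hmem : (fun i => (⟨r i, hev i⟩ : evenForms)) ∈ orbit r :=
    ⟨1, one_mem _, 1, fun i => by fin_cases i <;> simp [Fin.sum_univ_two]⟩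
  let path : ℝ → Fin 2 → evenForms := fun z i =>
    ⟨r i + z • (q i - r i), evenForms.add_mem (hev i)
      (evenForms.smul_mem z (evenForms.sub_mem (hq i) (hev i)))⟩
  have hpath : Continuous path :=
    continuous_pi fun i => Continuous.subtype_mk (continuous_pi fun k =>
      continuous_const.add (continuous_id.smul continuous_const)) _
  have hev0 : ∀ᶠ z in 𝓝 (0 : ℝ), path z ∈ orbit r := by
    refine hpath.continuousAt.eventually_mem (hopen.mem_nhds ?_)
    convert hmem using 2
    simp [path]
  have hzero : p = 0 := by
    refine Polynomial.eq_zero_of_infinite_isRoot p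
      (Set.Infinite.mono ?_ (infinite_of_mem_nhds 0 hev0))
    intro z hz
    have := horbit _ hz
    rw [Set.mem_ofPred_eq, Polynomial.IsRoot.def, ← hp]
    exact this
  apply hq0
  have := hp 1
  rwa [hzero, one_smul, add_sub_cancel, Polynomial.eval_zero] at this

/-! ### The derivative of the volume form -/

theorem spinorVec_smul_form (ν : KForm 5) (c : ℝ) (φ ψ : Forms) :
    spinorVec (c • ν) φ ψ = c⁻¹ • spinorVec ν φ ψ :=
  eq_of_pairing_eq fun v => by
    rw [map_smul, LinearMap.smul_apply, pairing_spinorVec, pairing_spinorVec,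
      ContinuousAlternatingMap.smul_apply, smul_eq_mul, smul_eq_mul, div_mul_eq_div_div_swap,
      div_eq_inv_mul _ c]

theorem spinorSq_volForm (ν : KForm 5) (r : Fin 2 → Forms) (φ : Forms) :
    spinorSq (volForm ν r) φ = (√|quartic ν r|)⁻¹ • spinorSq ν φ :=
  spinorVec_smul_form _ _ _ _

/-- The pair of odd forms that represents the derivative of the volume form at `r`, up to a sign
`(Q(r₂) · r₁, Q(r₁) · r₂) / ϕ(r)`. -/
def volDeriv (ν : KForm 5) (r : Fin 2 → Forms) : Fin 2 → Forms :=
  ![(SignType.sign (quartic ν r) : ℝ) • cliff (spinorSq (volForm ν r) (r 1)) (r 0),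
    (SignType.sign (quartic ν r) : ℝ) • cliff (spinorSq (volForm ν r) (r 0)) (r 1)]

theorem representsVolDeriv_volDeriv {ν : KForm 5} {r : Fin 2 → Forms}
    (hr : ∀ i, r i ∈ evenForms) (h0 : quartic ν r ≠ 0) :
    RepresentsVolDeriv ν r (volDeriv ν r) := by
  refine ⟨fun i => ?_, fun t _ => ?_⟩
  · fin_cases i
    · exact oddForms.smul_mem _ (cliff_mem_oddForms _ (hr 0))
    · exact oddForms.smul_mem _ (cliff_mem_oddForms _ (hr 1))
  obtain ⟨c₁, c₂, c₃, c₄, hc₁, hc⟩ := exists_quartic_add_smul ν r t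
  have h1 : HasDerivAt (fun z : ℝ => quartic ν (r + z • t)) c₁ 0 := by
    rw [show (fun z : ℝ => quartic ν (r + z • t)) = _ from funext hc]
    have hid := hasDerivAt_id (0 : ℝ)
    have := ((((hid.const_mul c₁).const_add (quartic ν r)).add
      ((hid.pow 2).const_mul c₂)).add ((hid.pow 3).const_mul c₃)).add ((hid.pow 4).const_mul c₄)
    exact this.congr_deriv (by simp)
  have hz : quartic ν (r + (0 : ℝ) • t) = quartic ν r := by simp
  have h2 : HasDerivAt (fun z : ℝ => |quartic ν (r + z • t)|)
      ((SignType.sign (quartic ν r) : ℝ) * c₁) 0 := by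
    have h3 := (hasDerivAt_abs (x := quartic ν (r + (0 : ℝ) • t)) (by rwa [hz])).comp 0 h1
    rw [hz] at h3
    exact h3
  refine (h2.sqrt (by rw [hz]; exact abs_ne_zero.2 h0)).congr_deriv ?_
  have hs : √|quartic ν r| ≠ 0 := (Real.sqrt_pos.2 (abs_pos.2 h0)).ne'
  rw [hz, Fin.sum_univ_two, ratio, ratio, ← mukaiForm_apply, ← mukaiForm_apply]
  simp only [volDeriv, Matrix.cons_val_zero, Matrix.cons_val_one, spinorSq_volForm, map_smul,
    LinearMap.smul_apply, smul_eq_mul, hc₁]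
  field_simp

/-- The derivative has one representative only, as the Mukai pairing is non-degenerate; so the
choice in `hat` is the explicit pair `volDeriv`. -/
theorem hat_eq_volDeriv {ν : KForm 5} (hν : ν ≠ 0) {r : Fin 2 → Forms}
    (hr : ∀ i, r i ∈ evenForms) (h0 : quartic ν r ≠ 0) : hat ν r = volDeriv ν r := by
  have h1 := representsVolDeriv_volDeriv hr h0
  have h2 : RepresentsVolDeriv ν r (hat ν r) := Classical.epsilon_spec ⟨_, h1⟩
  have hν' := stdVec_ne_zero_of_ne_zero hν
  funext i
  rw [← sub_eq_zero]
  refine eq_zero_of_mukaiForm_eq_zero (oddForms.sub_mem (h2.1 i) (h1.1 i)) fun t ht => ?_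
  have ht' : ∀ j, (Pi.single i t : Fin 2 → Forms) j ∈ evenForms := by
    intro j
    obtain rfl | hj := eq_or_ne j i
    · simpa using ht
    · simp [hj]
  have h3 := (h2.2 _ ht').unique (h1.2 _ ht')
  simp only [ratio, ← mukaiForm_apply, ← Finset.sum_div] at h3
  have h4 := (div_left_inj' hν').1 h3
  have h5 (s : Fin 2 → Forms) :
      ∑ j, mukaiForm (s j) ((Pi.single i t : Fin 2 → Forms) j) = mukaiForm (s i) t := by
    rw [Finset.sum_eq_single i (fun j _ hj => by simp [hj]) (by simp)]
    simp
  rw [h5, h5] at h4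
  rw [map_sub, LinearMap.sub_apply, h4, sub_self]

/-! ### Naturality under linear changes of coordinates -/

/-- The pull-back of a non-homogeneous form along a linear map. -/
def pullForms (L : E5 →L[ℝ] E5) (φ : Forms) : Forms :=
  fun k => (φ k).compContinuousLinearMap L

/-- The pull-back of an element of `T ⊕ T*` along a linear automorphism. -/
def pullGT (L : E5 ≃L[ℝ] E5) (u : GT) : GT := (L.symm u.1, u.2.comp (L : E5 →L[ℝ] E5))

theorem pullGT_add (L : E5 ≃L[ℝ] E5) (u w : GT) : pullGT L (u + w) = pullGT L u + pullGT L w := by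
  simp [pullGT]

theorem pullGT_smul (L : E5 ≃L[ℝ] E5) (c : ℝ) (u : GT) : pullGT L (c • u) = c • pullGT L u := by
  simp [pullGT]

theorem pairing_pullGT (L : E5 ≃L[ℝ] E5) (u w : GT) :
    pairing (pullGT L u) (pullGT L w) = pairing u w := by
  simp [pairing_apply, pullGT]

theorem pullGT_symm_pullGT (L : E5 ≃L[ℝ] E5) (u : GT) : pullGT L (pullGT L.symm u) = u := by
  refine Prod.ext ?_ ?_
  · simp [pullGT]
  · ext X
    simp [pullGT]

theorem pullForms_smul (L : E5 →L[ℝ] E5) (c : ℝ) (φ : Forms) :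
    pullForms L (c • φ) = c • pullForms L φ := rfl

theorem pullForms_mem_evenForms (L : E5 →L[ℝ] E5) {φ : Forms} (hφ : φ ∈ evenForms) :
    pullForms L φ ∈ evenForms := fun k hk => by
  rw [pullForms, hφ k hk]
  rfl

theorem covWedge_comp (L : E5 →L[ℝ] E5) (ξ : E5 →L[ℝ] ℝ) {k : ℕ} (α : KForm k) :
    (covWedge ξ α).compContinuousLinearMap L =
      covWedge (ξ.comp L) (α.compContinuousLinearMap L) := by
  ext v
  rw [ContinuousAlternatingMap.compContinuousLinearMap_apply, covWedge_apply, covWedge_apply]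
  rfl

theorem curryLeft_comp (L : E5 ≃L[ℝ] E5) (X : E5) {k : ℕ} (α : KForm (k + 1)) :
    (α.curryLeft X).compContinuousLinearMap (L : E5 →L[ℝ] E5) =
      (α.compContinuousLinearMap (L : E5 →L[ℝ] E5)).curryLeft (L.symm X) := by
  rw [ContinuousAlternatingMap.curryLeft_compContinuousLinearMap]
  simp

theorem pullForms_cliff (L : E5 ≃L[ℝ] E5) (u : GT) (φ : Forms) :
    pullForms L (cliff u φ) = cliff (pullGT L u) (pullForms L φ) := by
  funext k
  cases k with
  | zero =>
    rw [pullForms, cliff_apply_zero, cliff_apply_zero, curryLeft_comp]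
    rfl
  | succ k =>
    have h (α β : KForm (k + 1)) : (α + β).compContinuousLinearMap (L : E5 →L[ℝ] E5) =
        α.compContinuousLinearMap (L : E5 →L[ℝ] E5) +
          β.compContinuousLinearMap (L : E5 →L[ℝ] E5) := rfl
    rw [pullForms, cliff_apply_succ, cliff_apply_succ, h, curryLeft_comp, covWedge_comp]
    rfl

theorem topForm_comp (L : E5 →L[ℝ] E5) (f : E5 [⋀^Fin 5]→ₗ[ℝ] ℝ) :
    f (fun i => L (stdVec i)) = LinearMap.det (L : E5 →ₗ[ℝ] E5) * f stdVec := by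
  have h := f.eq_smul_basis_det stdBasis
  have he : (stdBasis : Fin 5 → E5) = stdVec := funext stdBasis_apply
  have h2 := stdBasis.det_comp (L : E5 →ₗ[ℝ] E5) stdBasis
  rw [Module.Basis.det_self, mul_one, he] at h2
  rw [h, AlternatingMap.smul_apply, AlternatingMap.smul_apply]
  rw [show (fun i => L (stdVec i)) = (L : E5 →ₗ[ℝ] E5) ∘ stdVec from rfl, h2]
  conv_rhs => rw [← he, Module.Basis.det_self]
  simp [mul_comm]

theorem wedge_comp (L : E5 →L[ℝ] E5) {k l : ℕ} (α : KForm k) (β : KForm l)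
    (v : Fin (k + l) → E5) :
    wedge (α.compContinuousLinearMap L) (β.compContinuousLinearMap L) v =
      wedge α β (fun i => L (v i)) := by
  have h0 (α : KForm k) (β : KForm l) (v : Fin (k + l) → E5) : wedge α β v =
    LinearMap.mul' ℝ ℝ
      ((α.toAlternatingMap.domCoprod β.toAlternatingMap) fun i => v (finSumFinEquiv i)) := rfl
  rw [h0, h0, AlternatingMap.domCoprod_apply, AlternatingMap.domCoprod_apply,
    _root_.sum_apply, _root_.sum_apply]
  congr 1
  refine Finset.sum_congr rfl fun q _ => ?_
  induction q using Quotient.inductionOn'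
  rfl

set_option maxRecDepth 10000 in
theorem mukaiForm_pullForms (L : E5 →L[ℝ] E5) (φ ψ : Forms) :
    mukaiForm (pullForms L φ) (pullForms L ψ) =
      LinearMap.det (L : E5 →ₗ[ℝ] E5) * mukaiForm φ ψ := by
  rw [mukaiForm_apply, mukaiForm_apply, ← topForm_comp]
  exact congrArg₂ (· + ·) (congrArg₂ (· + ·) (congrArg₂ (· - ·) (congrArg₂ (· - ·)
    (congrArg₂ (· + ·) (wedge_comp L (φ 0) (ψ 5) stdVec) (wedge_comp L (φ 1) (ψ 4) stdVec))
    (wedge_comp L (φ 2) (ψ 3) stdVec)) (wedge_comp L (φ 3) (ψ 2) stdVec))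
    (wedge_comp L (φ 4) (ψ 1) stdVec)) (wedge_comp L (φ 5) (ψ 0) stdVec)

theorem comp_stdVec (L : E5 →L[ℝ] E5) (ν : KForm 5) :
    ν.compContinuousLinearMap L stdVec = LinearMap.det (L : E5 →ₗ[ℝ] E5) * ν stdVec :=
  topForm_comp L ν.toAlternatingMap

theorem det_ne_zero (L : E5 ≃L[ℝ] E5) :
    LinearMap.det ((L : E5 →L[ℝ] E5) : E5 →ₗ[ℝ] E5) ≠ 0 :=
  (LinearEquiv.isUnit_det' L.toLinearEquiv).ne_zero

theorem comp_ne_zero (L : E5 ≃L[ℝ] E5) {ν : KForm 5} (hν : ν ≠ 0) :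
    ν.compContinuousLinearMap (L : E5 →L[ℝ] E5) ≠ 0 := by
  intro h
  have h1 := comp_stdVec (L : E5 →L[ℝ] E5) ν
  rw [h] at h1
  exact mul_ne_zero (det_ne_zero L) (stdVec_ne_zero_of_ne_zero hν) h1.symm

theorem spinorVec_pullForms (L : E5 ≃L[ℝ] E5) (ν : KForm 5) (φ ψ : Forms) :
    spinorVec (ν.compContinuousLinearMap (L : E5 →L[ℝ] E5)) (pullForms L φ) (pullForms L ψ) =
      pullGT L (spinorVec ν φ ψ) := by
  refine eq_of_pairing_eq fun v => ?_
  rw [← pullGT_symm_pullGT L v, pairing_pullGT, pairing_spinorVec, pairing_spinorVec,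
    ← pullForms_cliff, mukaiForm_pullForms, comp_stdVec, mul_div_mul_left _ _ (det_ne_zero L)]

theorem quartic_pullForms (L : E5 ≃L[ℝ] E5) (ν : KForm 5) (r : Fin 2 → Forms) :
    quartic (ν.compContinuousLinearMap (L : E5 →L[ℝ] E5)) (fun i => pullForms L (r i)) =
      quartic ν r := by
  simp only [quartic, spinorSq, spinorVec_pullForms, pairing_pullGT]

theorem volForm_pullForms (L : E5 ≃L[ℝ] E5) (ν : KForm 5) (r : Fin 2 → Forms) :
    volForm (ν.compContinuousLinearMap (L : E5 →L[ℝ] E5)) (fun i => pullForms L (r i)) =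
      (volForm ν r).compContinuousLinearMap (L : E5 →L[ℝ] E5) := by
  simp only [volForm, quartic_pullForms]
  rfl

theorem volDeriv_pullForms (L : E5 ≃L[ℝ] E5) (ν : KForm 5) (r : Fin 2 → Forms) (i : Fin 2) :
    volDeriv (ν.compContinuousLinearMap (L : E5 →L[ℝ] E5)) (fun i => pullForms L (r i)) i =
      pullForms L (volDeriv ν r i) := by
  fin_cases i <;>
    simp [volDeriv, quartic_pullForms, volForm_pullForms, spinorSq, spinorVec_pullForms,
      pullForms_smul, pullForms_cliff]

/-! ### Differentiation of fields of forms -/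

/-- The forms of degree at most `5`, as a finite-dimensional normed space. -/
abbrev TruncForms : Type := ∀ k : Fin 6, KForm k

/-- `Forms` is the space of forms of degree at most `5`, as all others vanish. -/
def trunc : Forms ≃ₗ[ℝ] TruncForms where
  toFun φ k := φ k
  map_add' _ _ := rfl
  map_smul' _ _ := rfl
  invFun φ k := if h : k < 6 then φ ⟨k, h⟩ else 0
  left_inv φ := by
    funext k
    by_cases h : k < 6
    · simp [h]
    · simp [h, kform_eq_zero_of_five_lt (by omega : 5 < k) (φ k)]
  right_inv φ := by
    funext k
    simp

theorem contDiffAt_trunc {n : WithTop ℕ∞} {φ : E5 → Forms} {y : E5}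
    (h : ∀ k, ContDiffAt ℝ n (fun z => φ z k) y) : ContDiffAt ℝ n (fun z => trunc (φ z)) y :=
  contDiffAt_pi.2 fun k => h k

/-- The derivative at `y`, in the direction `X`, of a field of non-homogeneous forms. -/
def dirD (φ : E5 → Forms) (y X : E5) : Forms := trunc.symm (fderiv ℝ (fun z => trunc (φ z)) y X)

theorem fderiv_component {φ : E5 → Forms} {y : E5}
    (h : DifferentiableAt ℝ (fun z => trunc (φ z)) y) (X : E5) (k : ℕ) :
    fderiv ℝ (fun z => φ z k) y X = dirD φ y X k := by
  by_cases hk : k < 6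
  · have h1 := (hasFDerivAt_pi'.1 h.hasFDerivAt) ⟨k, hk⟩
    rw [show fderiv ℝ (fun z => φ z k) y = _ from h1.fderiv]
    simp [dirD, trunc, hk]
  · rw [kform_eq_zero_of_five_lt (by omega : 5 < k) (dirD φ y X k),
      kform_eq_zero_of_five_lt (by omega : 5 < k) (fderiv ℝ (fun z => φ z k) y X)]

theorem dirD_sum (φ : E5 → Forms) (y X : E5) :
    dirD φ y X = ∑ a, X a • dirD φ y (stdVec a) := by
  conv_lhs => rw [← sum_smul_stdVec X]
  simp [dirD]

/-- The exterior derivative of a field of forms on `ℝ⁵`, as `∑ eᵃ ∧ ∂ₐ`. -/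
def flatD (φ : E5 → Forms) (y : E5) : Forms := ∑ a, cov a (dirD φ y (stdVec a))

theorem flatD_zero (φ : E5 → Forms) (y : E5) : flatD φ y 0 = 0 := by
  simp [flatD, Finset.sum_apply, cliff_apply_zero]

theorem extDeriv_eq_flatD {φ : E5 → Forms} {y : E5}
    (h : DifferentiableAt ℝ (fun z => trunc (φ z)) y) (k : ℕ) :
    extDeriv (fun z => φ z k) y = flatD φ y (k + 1) := by
  have h1 : fderiv ℝ (fun z => φ z k) y =
      ∑ a, (stdCovec a).smulRight (dirD φ y (stdVec a) k) := by
    ext1 X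
    rw [fderiv_component h, dirD_sum]
    simp [Finset.sum_apply, stdCovec]
  rw [extDeriv, h1, flatD, Finset.sum_apply,
    ← ContinuousAlternatingMap.alternatizeUncurryFinCLM_apply, map_sum]
  refine Finset.sum_congr rfl fun a _ => ?_
  rw [cliff_apply_succ]
  simp [covWedge]

theorem contDiffAt_bilinear {E F G : Type*} [NormedAddCommGroup E] [NormedSpace ℝ E]
    [NormedAddCommGroup F] [NormedSpace ℝ F] [NormedAddCommGroup G] [NormedSpace ℝ G]
    (B : E →L[ℝ] F →L[ℝ] G) {f : E5 → E} {g : E5 → F} {y : E5}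
    (hf : ContDiffAt ℝ ∞ f y) (hg : ContDiffAt ℝ ∞ g y) :
    ContDiffAt ℝ ∞ (fun z => B (f z) (g z)) y :=
  B.isBoundedBilinearMap.contDiff.contDiffAt.comp y (hf.prodMk hg)

/-- The Clifford action on truncated forms. -/
def cliffT : GT →L[ℝ] TruncForms →L[ℝ] TruncForms :=
  LinearMap.toContinuousBilinearMap
    (LinearMap.mk₂ ℝ (fun u φ => trunc (cliff u (trunc.symm φ)))
      (by simp) (by simp) (by simp) (by simp))

/-- The Mukai pairing on truncated forms. -/
def mukaiT : TruncForms →L[ℝ] TruncForms →L[ℝ] ℝ :=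
  LinearMap.toContinuousBilinearMap
    (LinearMap.mk₂ ℝ (fun φ ψ => mukaiForm (trunc.symm φ) (trunc.symm ψ))
      (by simp) (by simp) (by simp) (by simp))

/-- The inner product on `T ⊕ T*`, as a continuous bilinear map. -/
def pairingT : GT →L[ℝ] GT →L[ℝ] ℝ := pairing.toContinuousBilinearMap

theorem trunc_cliff (u : GT) (φ : Forms) : trunc (cliff u φ) = cliffT u (trunc φ) := by
  simp [cliffT]

theorem mukaiForm_eq_mukaiT (φ ψ : Forms) : mukaiForm φ ψ = mukaiT (trunc φ) (trunc ψ) := by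
  simp [mukaiT]

theorem differentiableAt_cliff {u : E5 → GT} {φ : E5 → Forms} {y : E5}
    (hu : DifferentiableAt ℝ u y) (hφ : DifferentiableAt ℝ (fun z => trunc (φ z)) y) :
    DifferentiableAt ℝ (fun z => trunc (cliff (u z) (φ z))) y := by
  simp only [trunc_cliff]
  exact (cliffT.hasFDerivAt_of_bilinear hu.hasFDerivAt hφ.hasFDerivAt).differentiableAt

theorem dirD_cliff {u : E5 → GT} {φ : E5 → Forms} {y : E5}
    (hu : DifferentiableAt ℝ u y) (hφ : DifferentiableAt ℝ (fun z => trunc (φ z)) y) (X : E5) :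
    dirD (fun z => cliff (u z) (φ z)) y X =
      cliff (fderiv ℝ u y X) (φ y) + cliff (u y) (dirD φ y X) := by
  have h := cliffT.hasFDerivAt_of_bilinear hu.hasFDerivAt hφ.hasFDerivAt
  simp only [dirD, trunc_cliff]
  rw [h.fderiv]
  simp [cliffT]
  abel

theorem hasFDerivAt_mukaiForm {φ ψ : E5 → Forms} {y : E5}
    (hφ : DifferentiableAt ℝ (fun z => trunc (φ z)) y)
    (hψ : DifferentiableAt ℝ (fun z => trunc (ψ z)) y) :
    DifferentiableAt ℝ (fun z => mukaiForm (φ z) (ψ z)) y ∧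
    ∀ X, fderiv ℝ (fun z => mukaiForm (φ z) (ψ z)) y X =
      mukaiForm (dirD φ y X) (ψ y) + mukaiForm (φ y) (dirD ψ y X) := by
  have h := mukaiT.hasFDerivAt_of_bilinear hφ.hasFDerivAt hψ.hasFDerivAt
  simp only [mukaiForm_eq_mukaiT]
  refine ⟨h.differentiableAt, fun X => ?_⟩
  rw [h.fderiv]
  simp [dirD]
  abel

theorem hasFDerivAt_pairing {u w : E5 → GT} {y : E5}
    (hu : DifferentiableAt ℝ u y) (hw : DifferentiableAt ℝ w y) :
    DifferentiableAt ℝ (fun z => pairing (u z) (w z)) y ∧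
    ∀ X, fderiv ℝ (fun z => pairing (u z) (w z)) y X =
      pairing (fderiv ℝ u y X) (w y) + pairing (u y) (fderiv ℝ w y X) := by
  have h := pairingT.hasFDerivAt_of_bilinear hu.hasFDerivAt hw.hasFDerivAt
  refine ⟨h.differentiableAt, fun X => ?_⟩
  have h1 : fderiv ℝ (fun z => pairing (u z) (w z)) y = _ := h.fderiv
  rw [h1]
  simp [pairingT]
  abel

/-! ### Smoothness of the spinor vectors -/

/-- The standard volume form of `ℝ⁵`. -/
def stdVol : KForm 5 := cov 0 (cov 1 (cov 2 (cov 3 (cov 4 oneForms)))) 5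

theorem stdVol_stdVec : stdVol stdVec = 1 := by
  have h : coord stdVol ![0, 1, 2, 3, 4] = 1 := by
    simp [stdVol, coord_oneForms_zero, coord_cliff_five, coord_cliff_four, coord_cliff_three,
      coord_cliff_two, coord_cliff_one, stdCovec_stdVec]
  rw [← h, coord]
  congr 1
  ext1 i
  fin_cases i <;> rfl

theorem spinorVec_eq_smul (ν : KForm 5) (φ ψ : Forms) :
    spinorVec ν φ ψ = (ν stdVec)⁻¹ • spinorVec stdVol φ ψ :=
  eq_of_pairing_eq fun v => by
    rw [map_smul, LinearMap.smul_apply, pairing_spinorVec, pairing_spinorVec, stdVol_stdVec,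
      div_one, smul_eq_mul, div_eq_inv_mul]

theorem quartic_eq_mul (ν : KForm 5) (r : Fin 2 → Forms) :
    quartic ν r = ((ν stdVec)⁻¹) ^ 2 * quartic stdVol r := by
  rw [quartic, quartic, spinorSq, spinorSq, spinorVec_eq_smul ν, spinorVec_eq_smul ν, map_smul,
    map_smul, LinearMap.smul_apply, smul_eq_mul, smul_eq_mul, spinorSq, spinorSq]
  ring

/-- The map `P` on truncated forms, relative to the standard volume form. -/
def spinorVecT : TruncForms →L[ℝ] TruncForms →L[ℝ] GT :=
  LinearMap.toContinuousBilinearMap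
    (LinearMap.mk₂ ℝ (fun φ ψ => spinorVec stdVol (trunc.symm φ) (trunc.symm ψ))
      (by simp [spinorVec_add_left]) (by simp [spinorVec_smul_left])
      (by simp [spinorVec_add_right]) (by simp [spinorVec_smul_right]))

theorem spinorVec_stdVol (φ ψ : Forms) :
    spinorVec stdVol φ ψ = spinorVecT (trunc φ) (trunc ψ) := by
  simp [spinorVecT]

section Smooth

variable {N : E5 → KForm 5} {R : E5 → Fin 2 → Forms} {y : E5}

theorem contDiffAt_apply_stdVec (hN : ContDiffAt ℝ ∞ N y) :
    ContDiffAt ℝ ∞ (fun z => N z stdVec) y := by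
  let e : KForm 5 →ₗ[ℝ] ℝ :=
    { toFun := fun ν => ν stdVec
      map_add' := fun _ _ => rfl
      map_smul' := fun _ _ => rfl }
  exact e.toContinuousLinearMap.contDiff.contDiffAt.comp y hN

theorem contDiffAt_spinorVec_stdVol (hR : ∀ i, ContDiffAt ℝ ∞ (fun z => trunc (R z i)) y)
    (i j : Fin 2) : ContDiffAt ℝ ∞ (fun z => spinorVec stdVol (R z i) (R z j)) y := by
  simp only [spinorVec_stdVol]
  exact contDiffAt_bilinear (E := TruncForms) (F := TruncForms) (G := GT) spinorVecT (hR i) (hR j)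

theorem contDiffAt_pairing {u w : E5 → GT} (hu : ContDiffAt ℝ ∞ u y) (hw : ContDiffAt ℝ ∞ w y) :
    ContDiffAt ℝ ∞ (fun z => pairing (u z) (w z)) y :=
  contDiffAt_bilinear (E := GT) (F := GT) (G := ℝ) pairingT hu hw

theorem contDiffAt_quartic (hN : ContDiffAt ℝ ∞ N y) (hN0 : N y ≠ 0)
    (hR : ∀ i, ContDiffAt ℝ ∞ (fun z => trunc (R z i)) y) :
    ContDiffAt ℝ ∞ (fun z => quartic (N z) (R z)) y := by
  simp only [quartic_eq_mul (N _)]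
  exact (((contDiffAt_apply_stdVec hN).inv (stdVec_ne_zero_of_ne_zero hN0)).pow 2).mul
    (contDiffAt_pairing (contDiffAt_spinorVec_stdVol hR 0 0) (contDiffAt_spinorVec_stdVol hR 1 1))

theorem volForm_stdVec (ν : KForm 5) (r : Fin 2 → Forms) :
    volForm ν r stdVec = √|quartic ν r| * ν stdVec := rfl

theorem volForm_stdVec_ne_zero {ν : KForm 5} {r : Fin 2 → Forms} (hν : ν ≠ 0)
    (h : quartic ν r ≠ 0) : volForm ν r stdVec ≠ 0 := by
  rw [volForm_stdVec]
  exact mul_ne_zero (Real.sqrt_pos.2 (abs_pos.2 h)).ne' (stdVec_ne_zero_of_ne_zero hν)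

theorem contDiffAt_volForm_stdVec (hN : ContDiffAt ℝ ∞ N y) (hN0 : N y ≠ 0)
    (hR : ∀ i, ContDiffAt ℝ ∞ (fun z => trunc (R z i)) y) (h0 : quartic (N y) (R y) ≠ 0) :
    ContDiffAt ℝ ∞ (fun z => volForm (N z) (R z) stdVec) y := by
  simp only [volForm_stdVec]
  have h1 := contDiffAt_quartic hN hN0 hR
  exact ((h1.abs h0).sqrt (abs_ne_zero.2 h0)).mul
    (contDiffAt_apply_stdVec hN)

theorem contDiffAt_spinorVec (hN : ContDiffAt ℝ ∞ N y) (hN0 : N y ≠ 0)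
    (hR : ∀ i, ContDiffAt ℝ ∞ (fun z => trunc (R z i)) y) (h0 : quartic (N y) (R y) ≠ 0)
    (i j : Fin 2) :
    ContDiffAt ℝ ∞ (fun z => spinorVec (volForm (N z) (R z)) (R z i) (R z j)) y := by
  simp only [spinorVec_eq_smul (volForm _ _)]
  exact ((contDiffAt_volForm_stdVec hN hN0 hR h0).inv (volForm_stdVec_ne_zero hN0 h0)).smul
    (contDiffAt_spinorVec_stdVol hR i j)

end Smooth

/-! ### The Lie derivative along a section of `T ⊕ T*` -/

/-- The action `∑ eᵃ · ∂ₐu · φ` on forms of the partial derivatives `δu a = ∂ₐu` of a section `u`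
of `T ⊕ T*` on `ℝ⁵`. If `X` is the vector part of `u`, the Lie derivative of `φ` along `u`, which is
`d (u · φ) + u · dφ`, equals `∂_X φ + spinAction δu φ`. -/
def spinAction (δu : Fin 5 → GT) (φ : Forms) : Forms := ∑ a, cov a (cliff (δu a) φ)

/-- The action on `T ⊕ T*` that corresponds to `spinAction`. If `X` is the vector part of `u`, the
Dorfman bracket of `u` and `w` equals `∂_X w + vecAction δu w`. -/
def vecAction (δu : Fin 5 → GT) (v : GT) : GT :=
  ∑ a, ((2 * pairing (δu a) v) • ((0, stdCovec a) : GT) - v.1 a • δu a)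

/-- The divergence of the vector part of `u`, from its partial derivatives. -/
def divergence (δu : Fin 5 → GT) : ℝ := ∑ a, (δu a).1 a

theorem cov_cliff (a : Fin 5) (v : GT) (φ : Forms) :
    cov a (cliff v φ) = v.1 a • φ - cliff v (cov a φ) := by
  have h := cliff_cliff_add_swap (0, stdCovec a) v φ
  rw [pairing_comm, pairing_stdCovec, mul_div_cancel₀ _ two_ne_zero] at h
  exact eq_sub_of_add_eq h

/-- `spinAction` and `vecAction` satisfy the Leibniz rule for the Clifford action. -/
theorem spinAction_cliff (δu : Fin 5 → GT) (v : GT) (φ : Forms) :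
    spinAction δu (cliff v φ) = cliff (vecAction δu v) φ + cliff v (spinAction δu φ) := by
  simp only [spinAction, vecAction, map_sum, LinearMap.sum_apply, ← Finset.sum_add_distrib]
  refine Finset.sum_congr rfl fun a _ => ?_
  have h := cliff_cliff_add_swap (δu a) v φ
  rw [eq_sub_of_add_eq h, map_sub, map_smul, cov_cliff a v (cliff (δu a) φ)]
  simp only [map_sub, map_smul, LinearMap.sub_apply, LinearMap.smul_apply]
  abel

/-- Up to the divergence, `spinAction` is skew-adjoint for the Mukai pairing. -/
theorem mukaiForm_spinAction (δu : Fin 5 → GT) (φ ψ : Forms) :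
    mukaiForm φ (spinAction δu ψ) =
      divergence δu * mukaiForm φ ψ - mukaiForm (spinAction δu φ) ψ := by
  simp only [spinAction, divergence, map_sum, LinearMap.sum_apply, Finset.sum_mul,
    ← Finset.sum_sub_distrib]
  refine Finset.sum_congr rfl fun a _ => ?_
  rw [← mukaiForm_cliff, ← mukaiForm_cliff, cov_cliff]
  simp

/-- `vecAction` is skew-adjoint for the inner product. -/
theorem pairing_vecAction (δu : Fin 5 → GT) (q v : GT) :
    pairing q (vecAction δu v) = -pairing (vecAction δu q) v := by
  simp only [vecAction, map_sum, LinearMap.sum_apply, ← Finset.sum_neg_distrib]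
  refine Finset.sum_congr rfl fun a _ => ?_
  simp only [map_sub, map_smul, LinearMap.sub_apply, LinearMap.smul_apply, pairing_stdCovec,
    pairing_comm (0, stdCovec a) v, smul_eq_mul, pairing_comm q (δu a)]
  ring

theorem vecAction_add (δu : Fin 5 → GT) (v w : GT) :
    vecAction δu (v + w) = vecAction δu v + vecAction δu w := by
  simp only [vecAction, ← Finset.sum_add_distrib]
  refine Finset.sum_congr rfl fun a _ => ?_
  simp only [map_add, Prod.fst_add, PiLp.add_apply]
  module

theorem vecAction_smul (δu : Fin 5 → GT) (c : ℝ) (v : GT) :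
    vecAction δu (c • v) = c • vecAction δu v := by
  simp only [vecAction, Finset.smul_sum]
  refine Finset.sum_congr rfl fun a _ => ?_
  simp only [map_smul, Prod.smul_fst, PiLp.smul_apply, smul_eq_mul]
  module

/-- If `φ` and `u · φ` are closed, then the Lie derivative of `φ` along `u` vanishes. -/
theorem dirD_eq_neg_spinAction {u : E5 → GT} {φ : E5 → Forms} {y : E5}
    (hu : DifferentiableAt ℝ u y) (hφ : DifferentiableAt ℝ (fun z => trunc (φ z)) y)
    (hd : flatD φ y = 0) (hdu : flatD (fun z => cliff (u z) (φ z)) y = 0) :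
    dirD φ y (u y).1 = -spinAction (fun a => fderiv ℝ u y (stdVec a)) (φ y) := by
  rw [flatD] at hdu
  simp only [dirD_cliff hu hφ, map_add, cov_cliff _ (u y), Finset.sum_add_distrib,
    Finset.sum_sub_distrib, ← map_sum] at hdu
  rw [flatD] at hd
  rw [hd, map_zero, sub_zero, ← dirD_sum] at hdu
  rw [spinAction]
  exact eq_neg_of_add_eq_zero_right hdu

/-- The derivative of `⟨v · φ, ψ⟩` along `u`, when the Lie derivatives of `φ` and `ψ` vanish. -/
theorem fderiv_mukaiForm_cliff {X y : E5} {δu : Fin 5 → GT} {φ ψ : E5 → Forms}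
    (hφ : DifferentiableAt ℝ (fun z => trunc (φ z)) y)
    (hψ : DifferentiableAt ℝ (fun z => trunc (ψ z)) y)
    (hLφ : dirD φ y X = -spinAction δu (φ y)) (hLψ : dirD ψ y X = -spinAction δu (ψ y)) (v : GT) :
    fderiv ℝ (fun z => mukaiForm (cliff v (φ z)) (ψ z)) y X =
      mukaiForm (cliff (vecAction δu v) (φ y)) (ψ y)
        - divergence δu * mukaiForm (cliff v (φ y)) (ψ y) := by
  have hv : DifferentiableAt ℝ (fun _ : E5 => v) y := differentiableAt_const v
  rw [(hasFDerivAt_mukaiForm (differentiableAt_cliff hv hφ) hψ).2, dirD_cliff hv hφ, hLφ, hLψ]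
  have h := spinAction_cliff δu v (φ y)
  have h2 := mukaiForm_spinAction δu (cliff v (φ y)) (ψ y)
  rw [h] at h2
  simp only [fderiv_fun_const, Pi.zero_apply, _root_.zero_apply, map_zero, LinearMap.zero_apply,
    zero_add, map_neg, LinearMap.neg_apply, h2, map_add, LinearMap.add_apply]
  ring

/-- The Lie derivative of `P(φ, ψ)`, divided by a volume form `N`, is a multiple of it; the factor
does not depend on `φ` and `ψ`. -/
theorem fderiv_spinorVec_add_vecAction {X y : E5} {δu : Fin 5 → GT} {φ ψ : E5 → Forms}
    {N : E5 → KForm 5}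
    (hφ : DifferentiableAt ℝ (fun z => trunc (φ z)) y)
    (hψ : DifferentiableAt ℝ (fun z => trunc (ψ z)) y)
    (hLφ : dirD φ y X = -spinAction δu (φ y)) (hLψ : dirD ψ y X = -spinAction δu (ψ y))
    (hN : DifferentiableAt ℝ (fun z => N z stdVec) y) (hN0 : N y stdVec ≠ 0)
    (hq : DifferentiableAt ℝ (fun z => spinorVec (N z) (φ z) (ψ z)) y) :
    fderiv ℝ (fun z => spinorVec (N z) (φ z) (ψ z)) y X +
        vecAction δu (spinorVec (N y) (φ y) (ψ y)) =
      -(divergence δu + fderiv ℝ (fun z => N z stdVec) y X / N y stdVec) •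
        spinorVec (N y) (φ y) (ψ y) := by
  refine eq_of_pairing_eq fun v => ?_
  have hv : DifferentiableAt ℝ (fun _ : E5 => v) y := differentiableAt_const v
  have h1 := fderiv_mukaiForm_cliff hφ hψ hLφ hLψ v
  have hne : ∀ᶠ z in 𝓝 y, N z stdVec ≠ 0 := hN.continuousAt.eventually_ne hN0
  have h2 : (fun z => mukaiForm (cliff v (φ z)) (ψ z)) =ᶠ[𝓝 y]
      fun z => pairing (spinorVec (N z) (φ z) (ψ z)) v * N z stdVec := by
    filter_upwards [hne] with z hz
    rw [pairing_spinorVec, div_mul_cancel₀ _ hz]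
  obtain ⟨h3, h4⟩ := hasFDerivAt_pairing hq hv
  rw [h2.fderiv_eq, fderiv_fun_mul h3 hN] at h1
  simp only [_root_.add_apply, _root_.smul_apply, h4, smul_eq_mul, fderiv_fun_const,
    Pi.zero_apply, _root_.zero_apply, map_zero, add_zero] at h1
  have h5 (w : GT) : mukaiForm (cliff w (φ y)) (ψ y) =
      pairing (spinorVec (N y) (φ y) (ψ y)) w * N y stdVec := by
    rw [pairing_spinorVec, div_mul_cancel₀ _ hN0]
  rw [h5, h5, pairing_vecAction] at h1
  simp only [map_add, map_smul, LinearMap.add_apply, LinearMap.smul_apply, smul_eq_mul]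
  field_simp
  linarith

/-! ### The distinguished sections -/

/-- The element `c₀ v₁ + c₁ h + c₂ v₂` of the space spanned by the coefficients of
`Q(r₁ + z r₂) / ϕ(r)`. -/
def distinguished (ν : KForm 5) (r : Fin 2 → Forms) (c : Fin 3 → ℝ) : GT :=
  c 0 • spinorVec (volForm ν r) (r 0) (r 0) + c 1 • spinorVec (volForm ν r) (r 0) (r 1) +
    c 2 • spinorVec (volForm ν r) (r 1) (r 1)

theorem spinorVec_self (ν : KForm 5) (φ : Forms) : spinorVec ν φ φ = spinorSq ν φ := rfl

theorem distinguished_pullForms (L : E5 ≃L[ℝ] E5) (ν : KForm 5) (r : Fin 2 → Forms)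
    (c : Fin 3 → ℝ) :
    distinguished (ν.compContinuousLinearMap (L : E5 →L[ℝ] E5)) (fun i => pullForms L (r i)) c =
      pullGT L (distinguished ν r c) := by
  simp only [distinguished, volForm_pullForms, spinorVec_pullForms, pullGT_add, pullGT_smul]

/-- Normalised by the volume form, the inner product of the two spinor squares is `±1`. -/
theorem pairing_spinorVec_volForm_sq {ν : KForm 5} {r : Fin 2 → Forms} (h0 : quartic ν r ≠ 0) :
    pairing (spinorVec (volForm ν r) (r 0) (r 0)) (spinorVec (volForm ν r) (r 1) (r 1)) ^ 2 =
      1 := by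
  have h : pairing (spinorVec (volForm ν r) (r 0) (r 0))
      (spinorVec (volForm ν r) (r 1) (r 1)) = (√|quartic ν r|)⁻¹ ^ 2 * quartic ν r := by
    rw [volForm, spinorVec_smul_form, spinorVec_smul_form, map_smul, map_smul,
      LinearMap.smul_apply, smul_eq_mul, smul_eq_mul, ← mul_assoc, ← pow_two]
    rfl
  rw [h, inv_pow, Real.sq_sqrt (abs_nonneg _), mul_pow, inv_pow, sq_abs]
  exact inv_mul_cancel₀ (pow_ne_zero 2 h0)

/-- The coefficients of `Q(r₁ + z r₂)` are linearly independent, because their Gram matrix is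
non-degenerate. -/
theorem linearIndependent_distinguished {ν : KForm 5} {r : Fin 2 → Forms}
    (hr : ∀ i, r i ∈ evenForms) (h0 : quartic ν r ≠ 0) :
    LinearIndependent ℝ ![spinorVec (volForm ν r) (r 0) (r 0),
      spinorVec (volForm ν r) (r 0) (r 1), spinorVec (volForm ν r) (r 1) (r 1)] := by
  set μ := volForm ν r
  have h00 := pairing_spinorSq_self μ (hr 0)
  have h11 := pairing_spinorSq_self μ (hr 1)
  have h01 := pairing_spinorSq_spinorVec μ (r 1) (hr 0)
  have h10 := pairing_spinorSq_spinorVec μ (r 0) (hr 1)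
  have hhh := pairing_spinorVec_self μ (hr 0) (hr 1)
  have hF : pairing (spinorSq μ (r 0)) (spinorSq μ (r 1)) ≠ 0 := by
    intro h
    have := pairing_spinorVec_volForm_sq h0
    rw [spinorSq, spinorSq] at h
    rw [h] at this
    norm_num at this
  rw [spinorVec_comm] at h10
  rw [Fintype.linearIndependent_iff]
  intro g hg
  have e0 := congrArg (pairing (spinorSq μ (r 0))) hg
  have e1 := congrArg (pairing (spinorVec μ (r 0) (r 1))) hg
  have e2 := congrArg (pairing (spinorSq μ (r 1))) hg
  simp [Fin.sum_univ_three, spinorVec_self, h00, h11, h01, h10, hhh, hF,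
    pairing_comm (spinorVec μ (r 0) (r 1)) (spinorSq μ _),
    pairing_comm (spinorSq μ (r 1)) (spinorSq μ (r 0))] at e0 e1 e2
  intro i
  fin_cases i <;> assumption

theorem cliff_spinorVec_left (ν : KForm 5) {φ ψ : Forms} (hφ : φ ∈ evenForms)
    (hψ : ψ ∈ evenForms) :
    cliff (spinorVec ν φ ψ) φ = -(1 / 2 : ℝ) • cliff (spinorSq ν φ) ψ := by
  have h := cliff_spinorSq_add_cliff_spinorVec ν hφ hψ
  rw [add_comm, add_eq_zero_iff_eq_neg] at h
  have h2 := congrArg (fun x => (1 / 2 : ℝ) • x) h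
  simp only [smul_smul, smul_neg] at h2
  norm_num at h2
  rw [h2]
  module

/-- The forms `u · r₁` and `u · r₂`, for `u` in the distinguished space, are combinations of
`Q(r₂) · r₁` and `Q(r₁) · r₂`, the two components of the derivative of the volume form. -/
theorem cliff_distinguished (ν : KForm 5) {r : Fin 2 → Forms} (hr : ∀ i, r i ∈ evenForms)
    (c : Fin 3 → ℝ) :
    cliff (distinguished ν r c) (r 0) =
      (-(1 / 2) * c 1) • cliff (spinorSq (volForm ν r) (r 0)) (r 1) +
        c 2 • cliff (spinorSq (volForm ν r) (r 1)) (r 0) ∧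
    cliff (distinguished ν r c) (r 1) =
      c 0 • cliff (spinorSq (volForm ν r) (r 0)) (r 1) +
        (-(1 / 2) * c 1) • cliff (spinorSq (volForm ν r) (r 1)) (r 0) := by
  have h0 := cliff_spinorSq_self (volForm ν r) (hr 0)
  have h1 := cliff_spinorSq_self (volForm ν r) (hr 1)
  have h2 := cliff_spinorVec_left (volForm ν r) (hr 0) (hr 1)
  have h3 := cliff_spinorVec_left (volForm ν r) (hr 1) (hr 0)
  rw [spinorVec_comm] at h3
  simp only [distinguished, map_add, map_smul, LinearMap.add_apply, LinearMap.smul_apply,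
    spinorVec_self, h0, h1, h2, h3]
  constructor <;> module

section Flat

variable {N : E5 → KForm 5} {R : E5 → Fin 2 → Forms} {y : E5}

theorem contDiffAt_distinguished (hN : ContDiffAt ℝ ∞ N y) (hN0 : N y ≠ 0)
    (hR : ∀ i, ContDiffAt ℝ ∞ (fun z => trunc (R z i)) y) (h0 : quartic (N y) (R y) ≠ 0)
    (c : Fin 3 → ℝ) : ContDiffAt ℝ ∞ (fun z => distinguished (N z) (R z) c) y := by
  have h := contDiffAt_spinorVec hN hN0 hR h0
  exact (((h 0 0).const_smul (c 0)).add ((h 0 1).const_smul (c 1))).add ((h 1 1).const_smul (c 2))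

theorem dirD_congr {φ ψ : E5 → Forms} (h : φ =ᶠ[𝓝 y] ψ) (X : E5) : dirD φ y X = dirD ψ y X := by
  have h2 : (fun z => trunc (φ z)) =ᶠ[𝓝 y] fun z => trunc (ψ z) := by
    filter_upwards [h] with z hz
    rw [hz]
  rw [dirD, dirD, h2.fderiv_eq]

theorem flatD_congr {φ ψ : E5 → Forms} (h : φ =ᶠ[𝓝 y] ψ) : flatD φ y = flatD ψ y := by
  simp only [flatD, dirD_congr h]

theorem flatD_smul {φ : E5 → Forms} (hφ : DifferentiableAt ℝ (fun z => trunc (φ z)) y) (a : ℝ) :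
    flatD (fun z => a • φ z) y = a • flatD φ y := by
  have h (X : E5) : dirD (fun z => a • φ z) y X = a • dirD φ y X := by
    simp only [dirD, map_smul]
    rw [fderiv_fun_const_smul hφ, _root_.smul_apply, map_smul]
  simp only [flatD, h, map_smul, Finset.smul_sum]

theorem flatD_smul_add_smul {φ ψ : E5 → Forms}
    (hφ : DifferentiableAt ℝ (fun z => trunc (φ z)) y)
    (hψ : DifferentiableAt ℝ (fun z => trunc (ψ z)) y) (a b : ℝ) :
    flatD (fun z => a • φ z + b • ψ z) y = a • flatD φ y + b • flatD ψ y := by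
  have h (X : E5) : dirD (fun z => a • φ z + b • ψ z) y X = a • dirD φ y X + b • dirD ψ y X := by
    simp only [dirD, map_add, map_smul]
    have ha : DifferentiableAt ℝ (fun z => a • trunc (φ z)) y := hφ.const_smul a
    have hb : DifferentiableAt ℝ (fun z => b • trunc (ψ z)) y := hψ.const_smul b
    rw [fderiv_fun_add ha hb, fderiv_fun_const_smul hφ,
      fderiv_fun_const_smul hψ, _root_.add_apply, _root_.smul_apply, _root_.smul_apply,
      map_add, map_smul, map_smul]
  simp only [flatD, h, map_add, map_smul, Finset.smul_sum, Finset.sum_add_distrib]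

theorem eventually_quartic_ne_zero (hN : ContDiffAt ℝ ∞ N y) (hN0 : N y ≠ 0)
    (hR : ∀ i, ContDiffAt ℝ ∞ (fun z => trunc (R z i)) y) (h0 : quartic (N y) (R y) ≠ 0) :
    ∀ᶠ z in 𝓝 y, quartic (N z) (R z) ≠ 0 ∧
      SignType.sign (quartic (N z) (R z)) = SignType.sign (quartic (N y) (R y)) := by
  have hc := (contDiffAt_quartic hN hN0 hR).continuousAt
  rcases lt_or_gt_of_ne h0 with h | h
  · filter_upwards [hc.eventually_lt_const h] with z hz
    exact ⟨hz.ne, by rw [sign_neg hz, sign_neg h]⟩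
  · filter_upwards [hc.eventually_const_lt h] with z hz
    exact ⟨hz.ne', by rw [sign_pos hz, sign_pos h]⟩

theorem differentiableAt_volDeriv
    (hN : ContDiffAt ℝ ∞ N y) (hN0 : N y ≠ 0)
    (hR : ∀ i, ContDiffAt ℝ ∞ (fun z => trunc (R z i)) y) (h0 : quartic (N y) (R y) ≠ 0)
    (i : Fin 2) : DifferentiableAt ℝ (fun z => trunc (volDeriv (N z) (R z) i)) y := by
  have key (i j : Fin 2) : DifferentiableAt ℝ (fun z => trunc
      ((SignType.sign (quartic (N z) (R z)) : ℝ) •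
        cliff (spinorSq (volForm (N z) (R z)) (R z i)) (R z j))) y := by
    have h := (differentiableAt_cliff (φ := fun z => R z j)
      ((contDiffAt_spinorVec hN hN0 hR h0 i i).differentiableAt (by simp))
      ((hR j).differentiableAt (by simp))).const_smul (SignType.sign (quartic (N y) (R y)) : ℝ)
    refine h.congr_of_eventuallyEq ?_
    filter_upwards [eventually_quartic_ne_zero hN hN0 hR h0] with z hz
    rw [hz.2, map_smul]
    rfl
  fin_cases i
  · exact key 1 0
  · exact key 0 1

/-- The equations `dρ̂ = 0`. The sign of the quartic drops out, as it is locally constant. -/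
theorem flatD_cliff_spinorSq (hN : ContDiffAt ℝ ∞ N y) (hN0 : N y ≠ 0)
    (hR : ∀ i, ContDiffAt ℝ ∞ (fun z => trunc (R z i)) y) (h0 : quartic (N y) (R y) ≠ 0)
    (hdv : ∀ i, flatD (fun z => volDeriv (N z) (R z) i) y = 0) :
    flatD (fun z => cliff (spinorSq (volForm (N z) (R z)) (R z 1)) (R z 0)) y = 0 ∧
      flatD (fun z => cliff (spinorSq (volForm (N z) (R z)) (R z 0)) (R z 1)) y = 0 := by
  have hev := eventually_quartic_ne_zero hN hN0 hR h0
  have hP := contDiffAt_spinorVec hN hN0 hR h0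
  have hne : ((SignType.sign (quartic (N y) (R y)) : SignType) : ℝ) ≠ 0 := by
    rcases lt_or_gt_of_ne h0 with h | h
    · simp [sign_neg h]
    · simp [sign_pos h]
  have key (i j : Fin 2) (h : flatD (fun z => (SignType.sign (quartic (N z) (R z)) : ℝ) •
      cliff (spinorSq (volForm (N z) (R z)) (R z i)) (R z j)) y = 0) :
      flatD (fun z => cliff (spinorSq (volForm (N z) (R z)) (R z i)) (R z j)) y = 0 := by
    have hd : DifferentiableAt ℝ
        (fun z => trunc (cliff (spinorSq (volForm (N z) (R z)) (R z i)) (R z j))) y :=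
      differentiableAt_cliff ((hP i i).differentiableAt (by simp))
        ((hR j).differentiableAt (by simp))
    have h2 := flatD_smul hd (SignType.sign (quartic (N y) (R y)) : ℝ)
    rw [flatD_congr (ψ := fun z => (SignType.sign (quartic (N y) (R y)) : ℝ) •
      cliff (spinorSq (volForm (N z) (R z)) (R z i)) (R z j))
      (by filter_upwards [hev] with z hz; rw [hz.2]), h2] at h
    exact (smul_eq_zero.1 h).resolve_left hne
  exact ⟨key 1 0 (hdv 0), key 0 1 (hdv 1)⟩

/-- In flat coordinates, the Dorfman bracket of two distinguished sections vanishes. -/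
theorem dorfman_distinguished (hN : ContDiffAt ℝ ∞ N y) (hN0 : N y ≠ 0)
    (hR : ∀ i, ContDiffAt ℝ ∞ (fun z => trunc (R z i)) y) (h0 : quartic (N y) (R y) ≠ 0)
    (hev : ∀ᶠ z in 𝓝 y, ∀ i, R z i ∈ evenForms)
    (hd : ∀ i, flatD (fun z => R z i) y = 0)
    (hdv : ∀ i, flatD (fun z => volDeriv (N z) (R z) i) y = 0) (c c' : Fin 3 → ℝ) :
    fderiv ℝ (fun z => distinguished (N z) (R z) c') y (distinguished (N y) (R y) c).1 +
      vecAction (fun a => fderiv ℝ (fun z => distinguished (N z) (R z) c) y (stdVec a))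
        (distinguished (N y) (R y) c') = 0 := by
  have hP (i j : Fin 2) := (contDiffAt_spinorVec hN hN0 hR h0 i j).differentiableAt (by simp)
  have hQ (i : Fin 2) :
      DifferentiableAt ℝ (fun z => spinorSq (volForm (N z) (R z)) (R z i)) y := hP i i
  have hRd (i : Fin 2) := (hR i).differentiableAt (by simp)
  have hu := (contDiffAt_distinguished hN hN0 hR h0 c).differentiableAt (by simp)
  obtain ⟨hC0, hC1⟩ := flatD_cliff_spinorSq hN hN0 hR h0 hdv
  have hclosed (i : Fin 2) :
      flatD (fun z => cliff (distinguished (N z) (R z) c) (R z i)) y = 0 := by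
    fin_cases i
    · rw [flatD_congr (ψ := fun z => _)
        (by filter_upwards [hev] with z hz; exact (cliff_distinguished (N z) hz c).1),
        flatD_smul_add_smul (differentiableAt_cliff (hQ 0) (hRd 1))
          (differentiableAt_cliff (hQ 1) (hRd 0)), hC0, hC1]
      simp
    · rw [flatD_congr (ψ := fun z => _)
        (by filter_upwards [hev] with z hz; exact (cliff_distinguished (N z) hz c).2),
        flatD_smul_add_smul (differentiableAt_cliff (hQ 0) (hRd 1))
          (differentiableAt_cliff (hQ 1) (hRd 0)), hC0, hC1]
      simp
  have hL (i : Fin 2) := dirD_eq_neg_spinAction hu (hRd i) (hd i) (hclosed i)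
  have hV := (contDiffAt_volForm_stdVec hN hN0 hR h0).differentiableAt (by simp)
  have hV0 := volForm_stdVec_ne_zero hN0 h0
  have main (i j : Fin 2) := fderiv_spinorVec_add_vecAction (hRd i) (hRd j) (hL i) (hL j) hV hV0
    (hP i j)
  -- the common factor vanishes, as the inner product of two of the sections is constant
  generalize hl : divergence (fun a => fderiv ℝ (fun z => distinguished (N z) (R z) c) y
    (stdVec a)) + fderiv ℝ (fun z => volForm (N z) (R z) stdVec) y
      (distinguished (N y) (R y) c).1 / volForm (N y) (R y) stdVec = l at main
  set X := (distinguished (N y) (R y) c).1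
  set δu := fun a => fderiv ℝ (fun z => distinguished (N z) (R z) c) y (stdVec a)
  have hl0 : l = 0 := by
    obtain ⟨hF, hF'⟩ := hasFDerivAt_pairing (hP 0 0) (hP 1 1)
    have hsq : (fun z => pairing (spinorVec (volForm (N z) (R z)) (R z 0) (R z 0))
        (spinorVec (volForm (N z) (R z)) (R z 1) (R z 1)) ^ 2) =ᶠ[𝓝 y] fun _ => 1 := by
      filter_upwards [eventually_quartic_ne_zero hN hN0 hR h0] with z hz
      exact pairing_spinorVec_volForm_sq hz.1
    have h1 := congrArg (fun f : E5 →L[ℝ] ℝ => f X) hsq.fderiv_eq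
    have h1sq := pairing_spinorVec_volForm_sq h0
    have h2 := hF' X
    rw [eq_sub_of_add_eq (main 0 0), eq_sub_of_add_eq (main 1 1)] at h2
    simp only [map_sub, map_smul, LinearMap.sub_apply, LinearMap.smul_apply, smul_eq_mul,
      pairing_vecAction] at h2
    rw [fderiv_fun_pow 2 hF] at h1
    simp only [_root_.smul_apply, h2, fderiv_fun_const, Pi.zero_apply, _root_.zero_apply,
      smul_eq_mul] at h1
    set F := pairing (spinorVec (volForm (N y) (R y)) (R y 0) (R y 0))
        (spinorVec (volForm (N y) (R y)) (R y 1) (R y 1))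
    have hF0 : F ≠ 0 := fun h => by simp [h] at h1sq
    norm_num [hF0] at h1
    exact h1
  simp only [hl0, neg_zero, zero_smul] at main
  have hw : fderiv ℝ (fun z => distinguished (N z) (R z) c') y X =
      c' 0 • fderiv ℝ (fun z => spinorVec (volForm (N z) (R z)) (R z 0) (R z 0)) y X +
      c' 1 • fderiv ℝ (fun z => spinorVec (volForm (N z) (R z)) (R z 0) (R z 1)) y X +
      c' 2 • fderiv ℝ (fun z => spinorVec (volForm (N z) (R z)) (R z 1) (R z 1)) y X := by
    have h := ((((hP 0 0).hasFDerivAt.const_smul (c' 0)).add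
      ((hP 0 1).hasFDerivAt.const_smul (c' 1))).add
      ((hP 1 1).hasFDerivAt.const_smul (c' 2))).fderiv
    exact congrArg (fun f : E5 →L[ℝ] GT => f X) h
  rw [hw, distinguished, vecAction_add, vecAction_add, vecAction_smul, vecAction_smul,
    vecAction_smul, eq_neg_of_add_eq_zero_left (main 0 0), eq_neg_of_add_eq_zero_left (main 0 1),
    eq_neg_of_add_eq_zero_left (main 1 1)]
  module

theorem vecAction_fderiv_fst (u : E5 → GT) (w : GT) :
    (vecAction (fun a => fderiv ℝ u y (stdVec a)) w).1 = -(fderiv ℝ u y w.1).1 := by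
  conv_rhs => rw [← sum_smul_stdVec w.1]
  simp [vecAction, Prod.fst_sum]

theorem vecAction_fderiv_snd (u : E5 → GT) (w : GT) (V : E5) :
    (vecAction (fun a => fderiv ℝ u y (stdVec a)) w).2 V =
      2 * pairing (fderiv ℝ u y V) w - (fderiv ℝ u y w.1).2 V := by
  have h1 : fderiv ℝ u y V = ∑ a, V a • fderiv ℝ u y (stdVec a) := by
    conv_lhs => rw [← sum_smul_stdVec V]
    simp
  have h2 : fderiv ℝ u y w.1 = ∑ a, w.1 a • fderiv ℝ u y (stdVec a) := by
    conv_lhs => rw [← sum_smul_stdVec w.1]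
    simp
  rw [h1, h2]
  simp only [vecAction, map_sum, map_smul, LinearMap.sum_apply, LinearMap.smul_apply,
    Prod.snd_sum, Prod.smul_snd, Prod.snd_sub, _root_.sum_apply, _root_.sub_apply,
    _root_.smul_apply, smul_eq_mul, Finset.sum_sub_distrib, Finset.mul_sum]
  congr 1
  refine Finset.sum_congr rfl fun a _ => ?_
  simp [stdCovec]
  ring

/-- The vanishing of the Dorfman brackets of `u` and `w`, in both orders, makes `(u, w)` constant
to first order. -/
theorem fderiv_pairing_eq_zero {u w : E5 → GT} (hu : DifferentiableAt ℝ u y)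
    (hw : DifferentiableAt ℝ w y)
    (huw : fderiv ℝ w y (u y).1 + vecAction (fun a => fderiv ℝ u y (stdVec a)) (w y) = 0)
    (hwu : fderiv ℝ u y (w y).1 + vecAction (fun a => fderiv ℝ w y (stdVec a)) (u y) = 0) :
    fderiv ℝ (fun z => pairing (u z) (w z)) y = 0 := by
  ext V
  have h1 := congrArg (fun v : GT => v.2 V) huw
  have h2 := congrArg (fun v : GT => v.2 V) hwu
  simp only [Prod.snd_add, _root_.add_apply, vecAction_fderiv_snd, Prod.snd_zero,
    _root_.zero_apply] at h1 h2
  rw [(hasFDerivAt_pairing hu hw).2, pairing_comm (u y), _root_.zero_apply]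
  linarith

end Flat

/-! ### Expressions in charts -/

section Charts

variable {M : Type*} [TopologicalSpace M] [ChartedSpace E5 M]

/-- The derivative at `x` of the preferred chart at `x₀`. -/
def dChart (x₀ x : M) : E5 →L[ℝ] E5 := mfderiv (𝓡 5) 𝓘(ℝ, E5) (extChartAt (𝓡 5) x₀) x

/-- The derivative at `y` of the inverse of the preferred chart at `x₀`. -/
def dChartSymm (x₀ : M) (y : E5) : E5 →L[ℝ] E5 :=
  mfderiv 𝓘(ℝ, E5) (𝓡 5) (extChartAt (𝓡 5) x₀).symm y

theorem dChart_self [IsManifold (𝓡 5) ∞ M] (x : M) : dChart x x = ContinuousLinearMap.id ℝ E5 := by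
  have : IsManifold (𝓡 5) 1 M := IsManifold.of_le (n := ∞) (by simp)
  exact mfderiv_extChartAt_self

theorem exists_equiv_eq_dChartSymm [IsManifold (𝓡 5) ∞ M] {x₀ : M} {y : E5}
    (hy : y ∈ (extChartAt (𝓡 5) x₀).target) : ∃ L : E5 ≃L[ℝ] E5,
      dChartSymm x₀ y = L ∧ dChart x₀ ((extChartAt (𝓡 5) x₀).symm y) = L.symm := by
  have : IsManifold (𝓡 5) 1 M := IsManifold.of_le (n := ∞) (by simp)
  have h1 := mfderiv_extChartAt_comp_mfderivWithin_extChartAt_symm hy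
  have h2 := mfderivWithin_extChartAt_symm_comp_mfderiv_extChartAt hy
  rw [ModelWithCorners.range_eq_univ, mfderivWithin_univ] at h1 h2
  exact ⟨ContinuousLinearEquiv.equivOfInverse (dChartSymm x₀ y) (dChart x₀ _)
    (fun v => congrArg (fun f : E5 →L[ℝ] E5 => f v) h1)
    (fun v => congrArg (fun f : E5 →L[ℝ] E5 => f v) h2), rfl, rfl⟩

theorem dChartSymm_self [IsManifold (𝓡 5) ∞ M] (x : M) :
    dChartSymm x (extChartAt (𝓡 5) x x) = ContinuousLinearMap.id ℝ E5 := by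
  obtain ⟨L, h1, h2⟩ := exists_equiv_eq_dChartSymm (mem_extChartAt_target (I := 𝓡 5) x)
  rw [extChartAt_to_inv, dChart_self] at h2
  rw [h1]
  ext1 v
  simpa using congrArg (fun f : E5 →L[ℝ] E5 => f (L v)) h2

/-- The expression of a non-homogeneous form in the preferred chart at `x₀`. -/
def formsInChart (x₀ : M) (φ : M → Forms) (y : E5) : Forms :=
  pullForms (dChartSymm x₀ y) (φ ((extChartAt (𝓡 5) x₀).symm y))

/-- The expression of a section of `T ⊕ T*` in the preferred chart at `x₀`. -/
def sectionInChart (x₀ : M) (u : M → GT) (y : E5) : GT :=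
  (dChart x₀ ((extChartAt (𝓡 5) x₀).symm y) (u ((extChartAt (𝓡 5) x₀).symm y)).1,
    (u ((extChartAt (𝓡 5) x₀).symm y)).2.comp (dChartSymm x₀ y))

theorem inChart_eq_formsInChart (x₀ : M) (φ : M → Forms) (k : ℕ) :
    inChart x₀ (fun x => φ x k) = fun y => formsInChart x₀ φ y k := rfl

theorem inChart_eq {k : ℕ} (x₀ : M) (α : M → KForm k) (y : E5) :
    inChart x₀ α y =
      (α ((extChartAt (𝓡 5) x₀).symm y)).compContinuousLinearMap (dChartSymm x₀ y) := rfl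

theorem inChart_oneForm (x₀ : M) (u : M → GT) (y : E5) :
    inChart x₀ (oneForm fun x => (u x).2) y =
      ContinuousAlternatingMap.ofSubsingleton ℝ E5 ℝ (0 : Fin 1) (sectionInChart x₀ u y).2 := by
  ext v; rfl

theorem inChart_zeroForm (x₀ : M) (f : M → ℝ) (y : E5) :
    inChart x₀ (zeroForm f) y =
      .constOfIsEmpty ℝ E5 (Fin 0) (f ((extChartAt (𝓡 5) x₀).symm y)) := by
  ext v; rfl

theorem extD_eq [IsManifold (𝓡 5) ∞ M] {k : ℕ} (α : M → KForm k) (x : M) :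
    extD α x = extDeriv (inChart x α) (extChartAt (𝓡 5) x x) := by
  refine (congrArg (fun L : E5 →L[ℝ] E5 =>
    (extDeriv (inChart x α) (extChartAt (𝓡 5) x x)).compContinuousLinearMap L)
      (dChart_self x)).trans ?_
  ext v; rfl

theorem sectionInChart_self [IsManifold (𝓡 5) ∞ M] (u : M → GT) (x : M) :
    sectionInChart x u (extChartAt (𝓡 5) x x) = u x := by
  rw [sectionInChart, extChartAt_to_inv, dChart_self, dChartSymm_self]
  rfl

theorem sectionInChart_eq_pullGT {x₀ : M} {y : E5} {L : E5 ≃L[ℝ] E5} (h1 : dChartSymm x₀ y = L)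
    (h2 : dChart x₀ ((extChartAt (𝓡 5) x₀).symm y) = L.symm) (u : M → GT) :
    sectionInChart x₀ u y = pullGT L (u ((extChartAt (𝓡 5) x₀).symm y)) := by
  rw [sectionInChart, h1, h2]; rfl

theorem pairing_sectionInChart [IsManifold (𝓡 5) ∞ M] {x₀ : M} {y : E5}
    (hy : y ∈ (extChartAt (𝓡 5) x₀).target) (u w : M → GT) :
    pairing (sectionInChart x₀ u y) (sectionInChart x₀ w y) =
      pairing (u ((extChartAt (𝓡 5) x₀).symm y)) (w ((extChartAt (𝓡 5) x₀).symm y)) := by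
  obtain ⟨L, h1, h2⟩ := exists_equiv_eq_dChartSymm hy
  rw [sectionInChart_eq_pullGT h1 h2, sectionInChart_eq_pullGT h1 h2, pairing_pullGT]

theorem eventually_mem_target (x : M) :
    ∀ᶠ y in 𝓝 (extChartAt (𝓡 5) x x), y ∈ (extChartAt (𝓡 5) x).target :=
  extChartAt_target_mem_nhds x

/-! ### The differential and the Courant bracket in a chart -/

variable [IsManifold (𝓡 5) ∞ M]

theorem diff_apply (f : M → ℝ) (x : M) :
    diff f x = fderiv ℝ (fun y => f ((extChartAt (𝓡 5) x).symm y)) (extChartAt (𝓡 5) x x) := by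
  ext V
  have h : inChart x (zeroForm f) = fun y =>
      .constOfIsEmpty ℝ E5 (Fin 0) (f ((extChartAt (𝓡 5) x).symm y)) :=
    funext (inChart_zeroForm x f)
  rw [diff, extD_eq, h, extDeriv_constOfIsEmpty]
  simp

theorem mlieBracket_eq_lieBracket (u w : M → GT) (x : M) :
    (VectorField.mlieBracket (𝓡 5) (fun y => (u y).1) (fun y => (w y).1) x : E5) =
      VectorField.lieBracket ℝ (fun y => (sectionInChart x u y).1)
        (fun y => (sectionInChart x w y).1) (extChartAt (𝓡 5) x x) := by
  let V (u : M → GT) (y : E5) : E5 :=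
    (dChartSymm x y).inverse (u ((extChartAt (𝓡 5) x).symm y)).1
  have hV (u : M → GT) : V u =ᶠ[𝓝 (extChartAt (𝓡 5) x x)] fun y => (sectionInChart x u y).1 := by
    filter_upwards [eventually_mem_target x] with y hy
    obtain ⟨L, h1, h2⟩ := exists_equiv_eq_dChartSymm hy
    simp only [V, sectionInChart, h1, h2, ContinuousLinearMap.inverse_equiv]
  have h1 : (VectorField.mlieBracket (𝓡 5) (fun y => (u y).1) (fun y => (w y).1) x : E5) =
      (dChart x x).inverse (VectorField.lieBracket ℝ (V u) (V w) (extChartAt (𝓡 5) x x)) := by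
    let W (s : Set E5) (u : M → GT) (y : E5) : E5 :=
      (show E5 →L[ℝ] E5 from mfderivWithin 𝓘(ℝ, E5) (𝓡 5) (extChartAt (𝓡 5) x).symm s y).inverse
        (u ((extChartAt (𝓡 5) x).symm y)).1
    have hW (u : M → GT) : W univ u = V u := by
      funext y
      exact congrArg (fun L : E5 →L[ℝ] E5 => L.inverse (u ((extChartAt (𝓡 5) x).symm y)).1)
        (congrFun mfderivWithin_univ y)
    change (dChart x x).inverse (VectorField.lieBracketWithin ℝ (W (range (𝓡 5)) u)
      (W (range (𝓡 5)) w) ((extChartAt (𝓡 5) x).symm ⁻¹' univ ∩ range (𝓡 5))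
      (extChartAt (𝓡 5) x x)) = _
    rw [preimage_univ, univ_inter, ModelWithCorners.range_eq_univ,
      VectorField.lieBracketWithin_univ, hW, hW]
  rw [h1, dChart_self, ContinuousLinearMap.inverse_id, ContinuousLinearMap.id_apply,
    VectorField.lieBracket, VectorField.lieBracket, (hV u).fderiv_eq, (hV w).fderiv_eq,
    (hV u).self_of_nhds, (hV w).self_of_nhds]

theorem fderiv_contraction {u w : M → GT} {x : M}
    (hu : DifferentiableAt ℝ (sectionInChart x u) (extChartAt (𝓡 5) x x))
    (hw : DifferentiableAt ℝ (sectionInChart x w) (extChartAt (𝓡 5) x x)) :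
    DifferentiableAt ℝ (fun y => (w ((extChartAt (𝓡 5) x).symm y)).2
        (u ((extChartAt (𝓡 5) x).symm y)).1) (extChartAt (𝓡 5) x x) ∧
      ∀ V, diff (fun x => (w x).2 (u x).1) x V =
        (w x).2 (fderiv ℝ (sectionInChart x u) (extChartAt (𝓡 5) x x) V).1 +
          (fderiv ℝ (sectionInChart x w) (extChartAt (𝓡 5) x x) V).2 (u x).1 := by
  have h1 := (hw.hasFDerivAt.snd).clm_apply hu.hasFDerivAt.fst
  have h2 : (fun y => (w ((extChartAt (𝓡 5) x).symm y)).2 (u ((extChartAt (𝓡 5) x).symm y)).1)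
      =ᶠ[𝓝 (extChartAt (𝓡 5) x x)]
        fun y => (sectionInChart x w y).2 (sectionInChart x u y).1 := by
    filter_upwards [eventually_mem_target x] with y hy
    obtain ⟨L, h1, h2⟩ := exists_equiv_eq_dChartSymm hy
    rw [sectionInChart_eq_pullGT h1 h2, sectionInChart_eq_pullGT h1 h2]
    simp [pullGT]
  refine ⟨h2.differentiableAt_iff.2 h1.differentiableAt, fun V => ?_⟩
  rw [diff_apply, h2.fderiv_eq, h1.fderiv, sectionInChart_self, sectionInChart_self]
  simp

theorem lieD_apply {u w : M → GT} {x : M}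
    (hu : DifferentiableAt ℝ (sectionInChart x u) (extChartAt (𝓡 5) x x))
    (hw : DifferentiableAt ℝ (sectionInChart x w) (extChartAt (𝓡 5) x x)) (V : E5) :
    lieD (fun y => (u y).1) (fun y => (w y).2) x V =
      (fderiv ℝ (sectionInChart x w) (extChartAt (𝓡 5) x x) (u x).1).2 V +
        (w x).2 (fderiv ℝ (sectionInChart x u) (extChartAt (𝓡 5) x x) V).1 := by
  have h1 := hw.hasFDerivAt.snd
  have h2 : inChart x (oneForm fun y => (w y).2) = fun y =>
      ContinuousAlternatingMap.ofSubsingleton ℝ E5 ℝ (0 : Fin 1) (sectionInChart x w y).2 :=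
    funext (inChart_oneForm x w)
  have h3 (Z V : E5) :
      fderiv ℝ (fun y => (sectionInChart x w y).2 V) (extChartAt (𝓡 5) x x) Z =
        (fderiv ℝ (sectionInChart x w) (extChartAt (𝓡 5) x x) Z).2 V := by
    rw [(h1.clm_apply (hasFDerivAt_const V _)).fderiv]
    simp
  have h4 : DifferentiableAt ℝ (fun y =>
      ContinuousAlternatingMap.ofSubsingleton ℝ E5 ℝ (0 : Fin 1) (sectionInChart x w y).2)
      (extChartAt (𝓡 5) x x) :=
    ((ContinuousAlternatingMap.ofSubsingletonLIE (𝕜 := ℝ) (E := E5) (F := ℝ)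
      (0 : Fin 1)).differentiable _).comp _ h1.differentiableAt
  have h5 : ((ContinuousAlternatingMap.ofSubsingleton ℝ E5 ℝ (0 : Fin 1)).symm
      ((extD (oneForm fun y => (w y).2) x).curryLeft (u x).1)) V =
      extD (oneForm fun y => (w y).2) x ![(u x).1, V] := by
    refine congrArg (extD (oneForm fun y => (w y).2) x) ?_
    funext i
    fin_cases i <;> rfl
  rw [lieD, _root_.add_apply, (fderiv_contraction hu hw).2, h5, extD_eq, h2, extDeriv_apply h4]
  simp only [ContinuousAlternatingMap.ofSubsingleton_apply_apply, h3]
  rw [Fin.sum_univ_two]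
  change (-1) ^ 0 • (fderiv ℝ (sectionInChart x w) (extChartAt (𝓡 5) x x) (u x).1).2 V +
    (-1) ^ 1 • (fderiv ℝ (sectionInChart x w) (extChartAt (𝓡 5) x x) V).2 (u x).1 + _ = _
  simp only [pow_zero, pow_one, one_smul, neg_smul]
  ring

/-- Two sections Courant-commute where their Dorfman brackets vanish in a chart, in both orders. -/
theorem courant_eq_zero {u w : M → GT} {x : M}
    (hu : DifferentiableAt ℝ (sectionInChart x u) (extChartAt (𝓡 5) x x))
    (hw : DifferentiableAt ℝ (sectionInChart x w) (extChartAt (𝓡 5) x x))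
    (huw : fderiv ℝ (sectionInChart x w) (extChartAt (𝓡 5) x x) (u x).1 +
      vecAction (fun a => fderiv ℝ (sectionInChart x u) (extChartAt (𝓡 5) x x) (stdVec a))
        (w x) = 0)
    (hwu : fderiv ℝ (sectionInChart x u) (extChartAt (𝓡 5) x x) (w x).1 +
      vecAction (fun a => fderiv ℝ (sectionInChart x w) (extChartAt (𝓡 5) x x) (stdVec a))
        (u x) = 0) : courant u w x = 0 := by
  refine Prod.ext ?_ ?_
  · refine (mlieBracket_eq_lieBracket u w x).trans ?_
    have h := congrArg Prod.fst huw
    rw [Prod.fst_add, vecAction_fderiv_fst] at h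
    rw [VectorField.lieBracket, sectionInChart_self, sectionInChart_self, fderiv.fst hu,
      fderiv.fst hw]
    exact h
  · ext V
    obtain ⟨hwu1, hwu2⟩ := fderiv_contraction hu hw
    obtain ⟨huw1, huw2⟩ := fderiv_contraction hw hu
    have h1 : diff (fun y => (w y).2 (u y).1 - (u y).2 (w y).1) x V =
        diff (fun y => (w y).2 (u y).1) x V - diff (fun y => (u y).2 (w y).1) x V := by
      rw [diff_apply, diff_apply, diff_apply, fderiv_fun_sub hwu1 huw1]
      rfl
    have h2 := congrArg (fun v : GT => v.2 V) huw
    have h3 := congrArg (fun v : GT => v.2 V) hwu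
    simp only [Prod.snd_add, _root_.add_apply, vecAction_fderiv_snd, Prod.snd_zero,
      _root_.zero_apply, pairing_apply] at h2 h3
    simp only [courant, _root_.sub_apply, _root_.smul_apply, smul_eq_mul, h1, hwu2, huw2,
      lieD_apply hu hw, lieD_apply hw hu, Prod.snd_zero, _root_.zero_apply]
    linarith

end Charts

/-! ### Critical pairs -/

section CriticalPairs

variable {M : Type*} [TopologicalSpace M] [ChartedSpace E5 M]

theorem SmoothForm.contDiffAt_inChart {k : ℕ} {α : M → KForm k} (hα : SmoothForm α) {x₀ : M}
    {y : E5} (hy : y ∈ (extChartAt (𝓡 5) x₀).target) : ContDiffAt ℝ ∞ (inChart x₀ α) y :=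
  (hα x₀).contDiffAt ((isOpen_extChartAt_target x₀).mem_nhds hy)

/-- A pair `ρ` of even forms that satisfies the equations of a critical point of the volume
functional: it is smooth and stable, and both `ρ` and `ρ̂` are closed. -/
structure IsCriticalPair (ν : M → KForm 5) (ρ : M → Fin 2 → Forms) : Prop where
  smooth_orientation : SmoothForm ν
  orientation_ne_zero : ∀ x, ν x ≠ 0
  smooth : ∀ i k, SmoothForm fun x => ρ x i k
  stable : ∀ x, IsStable (ρ x)
  closed : ∀ i x, extDForms (fun y => ρ y i) x = 0
  closed_hat : ∀ i x, extDForms (fun y => hat (ν y) (ρ y) i) x = 0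

variable {ν : M → KForm 5} {ρ : M → Fin 2 → Forms}

theorem IsCriticalPair.quartic_ne_zero (h : IsCriticalPair ν ρ) (x : M) : quartic (ν x) (ρ x) ≠ 0 :=
  (h.stable x).quartic_ne_zero (h.orientation_ne_zero x)

theorem IsCriticalPair.formsInChart_mem_evenForms (h : IsCriticalPair ν ρ) (x₀ : M) (y : E5)
    (i : Fin 2) :
    formsInChart x₀ (fun x => ρ x i) y ∈ evenForms :=
  pullForms_mem_evenForms _ ((h.stable _).1 i)

theorem IsCriticalPair.contDiffAt_formsInChart (h : IsCriticalPair ν ρ) {x₀ : M} {y : E5}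
    (hy : y ∈ (extChartAt (𝓡 5) x₀).target) (i : Fin 2) :
    ContDiffAt ℝ ∞ (fun z => trunc (formsInChart x₀ (fun x => ρ x i) z)) y :=
  contDiffAt_trunc fun k => (h.smooth i k).contDiffAt_inChart hy

variable [IsManifold (𝓡 5) ∞ M]

/-- A function whose derivative vanishes at the centre of each preferred chart is locally
constant. -/
theorem isLocallyConstant_of_hasFDerivAt_zero {f : M → ℝ}
    (hf : ∀ x, HasFDerivAt (fun y => f ((extChartAt (𝓡 5) x).symm y)) (0 : E5 →L[ℝ] ℝ)
      (extChartAt (𝓡 5) x x)) : IsLocallyConstant f := by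
  have hf1 (x : M) : HasMFDerivAt (𝓡 5) 𝓘(ℝ, ℝ) f x 0 := by
    refine ⟨?_, (hf x).hasFDerivWithinAt⟩
    have h1 : ContinuousAt (fun z => f ((extChartAt (𝓡 5) x).symm (extChartAt (𝓡 5) x z))) x :=
      ContinuousAt.comp (f := extChartAt (𝓡 5) x) (hf x).continuousAt (continuousAt_extChartAt x)
    refine h1.congr ?_
    filter_upwards [extChartAt_source_mem_nhds (I := 𝓡 5) x] with z hz
    rw [(extChartAt (𝓡 5) x).left_inv hz]
  refine fun s => isOpen_iff_mem_nhds.2 fun x hx => ?_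
  have hf2 : ∀ y ∈ (extChartAt (𝓡 5) x).target,
      HasFDerivAt (fun y => f ((extChartAt (𝓡 5) x).symm y)) (0 : E5 →L[ℝ] ℝ) y := by
    intro y hy
    have h1 : MDifferentiableAt 𝓘(ℝ, E5) (𝓡 5) (extChartAt (𝓡 5) x).symm y := by
      have : IsManifold (𝓡 5) 1 M := IsManifold.of_le (n := ∞) (by simp)
      have h2 := mdifferentiableWithinAt_extChartAt_symm hy
      rwa [ModelWithCorners.range_eq_univ, mdifferentiableWithinAt_univ] at h2
    have h3 := ((hf1 _).comp y h1.hasMFDerivAt).hasFDerivAt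
    exact h3.congr_fderiv (by ext V; rfl)
  have h2 := (isOpen_extChartAt_target (I := 𝓡 5) x).isOpen_inter_preimage_of_fderiv_eq_zero
    (fun y hy => (hf2 y hy).differentiableAt.differentiableWithinAt)
    (fun y hy => (hf2 y hy).fderiv) s
  have h3 := (continuousOn_extChartAt (I := 𝓡 5) x).isOpen_inter_preimage
    (isOpen_extChartAt_source x) h2
  refine Filter.mem_of_superset (h3.mem_nhds ⟨mem_extChartAt_source x,
    mem_extChartAt_target x, ?_⟩) ?_
  · rw [mem_preimage, extChartAt_to_inv]
    exact hx
  · rintro z ⟨hz, -, hz2⟩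
    rw [mem_preimage, (extChartAt (𝓡 5) x).left_inv hz] at hz2
    exact hz2

/-- A closed form has a closed expression in the chart, at the centre of the chart. -/
theorem flatD_formsInChart {φ : M → Forms} {x : M}
    (hφ : DifferentiableAt ℝ (fun z => trunc (formsInChart x φ z)) (extChartAt (𝓡 5) x x))
    (hd : extDForms φ x = 0) : flatD (formsInChart x φ) (extChartAt (𝓡 5) x x) = 0 := by
  funext k
  cases k with
  | zero => exact flatD_zero _ _
  | succ k =>
    rw [← extDeriv_eq_flatD hφ, ← inChart_eq_formsInChart, ← extD_eq]
    exact congrFun hd (k + 1)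

/-- A section of `T ⊕ T*` is smooth if its coordinate expressions are. -/
theorem smoothSection_of_contDiffAt {u : M → GT}
    (h : ∀ x₀ : M, ∀ y ∈ (extChartAt (𝓡 5) x₀).target, ContDiffAt ℝ ∞ (sectionInChart x₀ u) y) :
    SmoothSection u := by
  constructor
  · intro x₀
    refine (Bundle.contMDiffAt_section (E := TangentSpace (𝓡 5)) (s := fun x => (u x).1) x₀).2 ?_
    have h1 : ContMDiffAt (𝓡 5) 𝓘(ℝ, E5) ∞
        (fun x => (sectionInChart x₀ u (extChartAt (𝓡 5) x₀ x)).1) x₀ :=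
      (h x₀ _ (mem_extChartAt_target x₀)).fst.contMDiffAt.comp x₀ contMDiffAt_extChartAt
    refine h1.congr_of_eventuallyEq ?_
    filter_upwards [extChartAt_source_mem_nhds (I := 𝓡 5) x₀] with x hx
    have : IsManifold (𝓡 5) 1 M := IsManifold.of_le (n := ∞) (by simp)
    rw [extChartAt_source] at hx
    have h2 := TangentBundle.continuousLinearMapAt_trivializationAt (I := 𝓡 5) hx
    have h3 := Bundle.Trivialization.continuousLinearMapAt_apply_of_mem (R := ℝ)
      (e := trivializationAt E5 (TangentSpace (𝓡 5)) x₀) (b := x) (by simpa using hx) (u x).1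
    refine h3.symm.trans ((congrArg (fun L : E5 →L[ℝ] E5 => L (u x).1) h2).trans ?_)
    rw [← extChartAt_source (𝓡 5)] at hx
    rw [sectionInChart, (extChartAt (𝓡 5) x₀).left_inv hx]
    rfl
  · intro x₀ y hy
    rw [funext (inChart_oneForm x₀ u)]
    exact ((ContinuousAlternatingMap.ofSubsingletonLIE (𝕜 := ℝ) (E := E5) (F := ℝ)
      (0 : Fin 1)).contDiff.contDiffAt.comp y (h x₀ y hy).snd).contDiffWithinAt

namespace IsCriticalPair

theorem inChart_ne_zero (h : IsCriticalPair ν ρ) {x₀ : M} {y : E5}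
    (hy : y ∈ (extChartAt (𝓡 5) x₀).target) : inChart x₀ ν y ≠ 0 := by
  obtain ⟨L, h1, -⟩ := exists_equiv_eq_dChartSymm hy
  rw [inChart_eq, h1]
  exact comp_ne_zero L (h.orientation_ne_zero _)

theorem quartic_inChart_ne_zero (h : IsCriticalPair ν ρ) {x₀ : M} {y : E5}
    (hy : y ∈ (extChartAt (𝓡 5) x₀).target) :
    quartic (inChart x₀ ν y) (fun i => formsInChart x₀ (fun x => ρ x i) y) ≠ 0 := by
  obtain ⟨L, h1, -⟩ := exists_equiv_eq_dChartSymm hy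
  simp only [inChart_eq, formsInChart, h1, quartic_pullForms]
  exact h.quartic_ne_zero _

theorem formsInChart_hat (h : IsCriticalPair ν ρ) {x₀ : M} {y : E5}
    (hy : y ∈ (extChartAt (𝓡 5) x₀).target) (i : Fin 2) :
    formsInChart x₀ (fun x => hat (ν x) (ρ x) i) y =
      volDeriv (inChart x₀ ν y) (fun i => formsInChart x₀ (fun x => ρ x i) y) i := by
  obtain ⟨L, h1, -⟩ := exists_equiv_eq_dChartSymm hy
  simp only [inChart_eq, formsInChart, h1, volDeriv_pullForms]
  rw [hat_eq_volDeriv (h.orientation_ne_zero _) (h.stable _).1 (h.quartic_ne_zero _)]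

theorem sectionInChart_distinguished {x₀ : M} {y : E5}
    (hy : y ∈ (extChartAt (𝓡 5) x₀).target) (c : Fin 3 → ℝ) :
    sectionInChart x₀ (fun x => distinguished (ν x) (ρ x) c) y =
      distinguished (inChart x₀ ν y) (fun i => formsInChart x₀ (fun x => ρ x i) y) c := by
  obtain ⟨L, h1, h2⟩ := exists_equiv_eq_dChartSymm hy
  rw [sectionInChart_eq_pullGT h1 h2]
  simp only [inChart_eq, formsInChart, h1, distinguished_pullForms]

theorem sectionInChart_distinguished_eventuallyEq {x₀ : M} {y : E5}
    (hy : y ∈ (extChartAt (𝓡 5) x₀).target) (c : Fin 3 → ℝ) :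
    sectionInChart x₀ (fun x => distinguished (ν x) (ρ x) c) =ᶠ[𝓝 y] fun z =>
      distinguished (inChart x₀ ν z) (fun i => formsInChart x₀ (fun x => ρ x i) z) c :=
  eventually_of_mem ((isOpen_extChartAt_target x₀).mem_nhds hy) fun _ hz =>
    sectionInChart_distinguished hz c

theorem contDiffAt_sectionInChart (h : IsCriticalPair ν ρ) {x₀ : M} {y : E5}
    (hy : y ∈ (extChartAt (𝓡 5) x₀).target) (c : Fin 3 → ℝ) :
    ContDiffAt ℝ ∞ (sectionInChart x₀ fun x => distinguished (ν x) (ρ x) c) y :=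
  (contDiffAt_distinguished (h.smooth_orientation.contDiffAt_inChart hy) (h.inChart_ne_zero hy)
    (R := fun z i => formsInChart x₀ (fun x => ρ x i) z)
    (h.contDiffAt_formsInChart hy) (h.quartic_inChart_ne_zero hy) c).congr_of_eventuallyEq
    (sectionInChart_distinguished_eventuallyEq hy c)

/-- The Dorfman bracket of two distinguished sections vanishes at the centre of each preferred
chart. -/
theorem dorfman (h : IsCriticalPair ν ρ) (x : M) (c c' : Fin 3 → ℝ) :
    fderiv ℝ (sectionInChart x fun x => distinguished (ν x) (ρ x) c') (extChartAt (𝓡 5) x x)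
        (distinguished (ν x) (ρ x) c).1 +
      vecAction (fun a => fderiv ℝ (sectionInChart x fun x => distinguished (ν x) (ρ x) c)
        (extChartAt (𝓡 5) x x) (stdVec a)) (distinguished (ν x) (ρ x) c') = 0 := by
  have hy := mem_extChartAt_target (I := 𝓡 5) x
  have hN := h.smooth_orientation.contDiffAt_inChart hy
  have hN0 := h.inChart_ne_zero hy
  have hR := h.contDiffAt_formsInChart hy
  have h0 := h.quartic_inChart_ne_zero hy
  have key := dorfman_distinguished (R := fun z i => formsInChart x (fun x => ρ x i) z) hN hN0 hR h0
    (Eventually.of_forall fun z i => h.formsInChart_mem_evenForms x z i)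
    (fun i => flatD_formsInChart ((hR i).differentiableAt (by simp)) (h.closed i x))
    (fun i => by
      have he : formsInChart x (fun x => hat (ν x) (ρ x) i) =ᶠ[𝓝 (extChartAt (𝓡 5) x x)]
          fun z => volDeriv (inChart x ν z) (fun i => formsInChart x (fun x => ρ x i) z) i := by
        filter_upwards [eventually_mem_target x] with z hz
        exact h.formsInChart_hat hz i
      rw [← flatD_congr he]
      refine flatD_formsInChart ?_ (h.closed_hat i x)
      refine (differentiableAt_volDeriv (R := fun z i => formsInChart x (fun x => ρ x i) z)
        hN hN0 hR h0 i).congr_of_eventuallyEq ?_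
      filter_upwards [he] with z hz
      rw [hz]) c c'
  rw [← sectionInChart_distinguished hy, ← sectionInChart_distinguished hy,
    ← (sectionInChart_distinguished_eventuallyEq hy c).fderiv_eq,
    ← (sectionInChart_distinguished_eventuallyEq hy c').fderiv_eq,
    sectionInChart_self (fun x => distinguished (ν x) (ρ x) c),
    sectionInChart_self (fun x => distinguished (ν x) (ρ x) c')] at key
  exact key

theorem courant_distinguished (h : IsCriticalPair ν ρ) (c c' : Fin 3 → ℝ) (x : M) :
    courant (fun x => distinguished (ν x) (ρ x) c) (fun x => distinguished (ν x) (ρ x) c') x = 0 :=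
  courant_eq_zero
    ((h.contDiffAt_sectionInChart (mem_extChartAt_target x) c).differentiableAt (by simp))
    ((h.contDiffAt_sectionInChart (mem_extChartAt_target x) c').differentiableAt (by simp))
    (h.dorfman x c c') (h.dorfman x c' c)

theorem isLocallyConstant_pairing (h : IsCriticalPair ν ρ) (c c' : Fin 3 → ℝ) :
    IsLocallyConstant fun x =>
      pairing (distinguished (ν x) (ρ x) c) (distinguished (ν x) (ρ x) c') := by
  refine isLocallyConstant_of_hasFDerivAt_zero fun x => ?_
  have hy := mem_extChartAt_target (I := 𝓡 5) x
  have hu := (h.contDiffAt_sectionInChart hy c).differentiableAt (by simp)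
  have hw := (h.contDiffAt_sectionInChart hy c').differentiableAt (by simp)
  have h1 := (hasFDerivAt_pairing hu hw).1.hasFDerivAt
  rw [fderiv_pairing_eq_zero hu hw
    (by rw [sectionInChart_self, sectionInChart_self]; exact h.dorfman x c c')
    (by rw [sectionInChart_self, sectionInChart_self]; exact h.dorfman x c' c)] at h1
  refine h1.congr_of_eventuallyEq ?_
  filter_upwards [eventually_mem_target x] with y hy
  exact (pairing_sectionInChart hy (fun x => distinguished (ν x) (ρ x) c)
    (fun x => distinguished (ν x) (ρ x) c')).symm

end IsCriticalPair

end CriticalPairs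

end GenGeom

end

theorem mainTheorem3 {M : Type*} [TopologicalSpace M] [ChartedSpace E5 M]
    [IsManifold (𝓡 5) ∞ M] [Nonempty M]
    -- the orientation of `M`, given by a nowhere vanishing `5`-form
    (ν : M → KForm 5) (hν : SmoothForm ν) (hν0 : ∀ x, ν x ≠ 0)
    -- a smooth section `ρ = (ρ₁, ρ₂)` of `Λ^{ev}T* ⊗ ℝ²`, in an open orbit at each point
    (ρ : M → Fin 2 → Forms) (hρ : ∀ i k, SmoothForm fun x => ρ x i k)
    (hstable : ∀ x, IsStable (ρ x))
    -- the equations `dρ = 0 = dρ̂`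
    (hd : ∀ i x, extDForms (fun y => ρ y i) x = 0)
    (hdhat : ∀ i x, extDForms (fun y => hat (ν y) (ρ y) i) x = 0) :
    ∃ v₁ h v₂ : M → GT,
      (∀ (z : ℝ) (x : M), spinorSq (volForm (ν x) (ρ x)) (ρ x 0 + z • ρ x 1) =
        v₁ x + (2 * z) • h x + z ^ 2 • v₂ x) ∧
      (∀ x, LinearIndependent ℝ ![v₁ x, h x, v₂ x]) ∧
      Module.finrank ℝ (Submodule.span ℝ {v₁, h, v₂}) = 3 ∧
      (∀ u ∈ Submodule.span ℝ {v₁, h, v₂}, SmoothSection u) ∧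
      (∀ u ∈ Submodule.span ℝ {v₁, h, v₂}, ∀ w ∈ Submodule.span ℝ {v₁, h, v₂},
        (∀ x, courant u w x = 0) ∧
        IsLocallyConstant (fun x => pairing (u x) (w x)) ∧
        (PreconnectedSpace M → ∃ c : ℝ, ∀ x, pairing (u x) (w x) = c)) := by
  have H : IsCriticalPair ν ρ := ⟨hν, hν0, hρ, hstable, hd, hdhat⟩
  let P (i j : Fin 2) (x : M) : GT := spinorVec (volForm (ν x) (ρ x)) (ρ x i) (ρ x j)
  have hspan : ∀ u ∈ Submodule.span ℝ {P 0 0, P 0 1, P 1 1},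
      ∃ c : Fin 3 → ℝ, u = fun x => distinguished (ν x) (ρ x) c := by
    intro u hu
    obtain ⟨a, b, c, rfl⟩ := Submodule.mem_span_triple.1 hu
    exact ⟨![a, b, c], rfl⟩
  have hli (x : M) : LinearIndependent ℝ ![P 0 0 x, P 0 1 x, P 1 1 x] :=
    linearIndependent_distinguished (hstable x).1 (H.quartic_ne_zero x)
  refine ⟨P 0 0, P 0 1, P 1 1, fun z x => ?_, hli, ?_, fun u hu => ?_, fun u hu w hw => ?_⟩
  · exact spinorSq_add_smul _ _ _ z
  · obtain ⟨x⟩ := ‹Nonempty M›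
    have h1 : LinearIndependent ℝ ![P 0 0, P 0 1, P 1 1] := by
      refine LinearIndependent.of_comp (LinearMap.proj x) ?_
      convert hli x using 1
      funext i
      fin_cases i <;> rfl
    have h2 := finrank_span_eq_card h1
    rw [Matrix.range_cons, Matrix.range_cons, Matrix.range_cons, Matrix.range_empty,
      union_empty, singleton_union, singleton_union] at h2
    exact h2.trans (Fintype.card_fin 3)
  · obtain ⟨c, rfl⟩ := hspan u hu
    exact smoothSection_of_contDiffAt fun x₀ y hy => H.contDiffAt_sectionInChart hy c
  · obtain ⟨c, rfl⟩ := hspan u hu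
    obtain ⟨c', rfl⟩ := hspan w hw
    have hc := H.isLocallyConstant_pairing c c'
    refine ⟨H.courant_distinguished c c', hc, fun _ => ?_⟩
    obtain ⟨x⟩ := ‹Nonempty M›
    exact ⟨_, fun x' => hc.apply_eq_of_preconnectedSpace x' x⟩
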